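/- **Setting.** Let $n\ge 1$, $m\ge 0$, $s\ge 1$, let $X$ be a smooth manifold of dimension $N=n+m$, and let $P^s_nX$ be the bundle of $s$-contact elements of $n$-dimensional submanifolds of $X$ (regular $s$-velocities $j^s_0\gamma$ of immersions $\gamma:\mathbb R^n\to X$ modulo reparametrization). A chart $(x^i,y^\sigma)$ of $X$ ($i\le n$, $\sigma\le m$) induces coordinates $(x^i,y^\sigma_I)_{|I|\le s}$ on $P^s_nX$: on the contact element of the graph $y=f(x)$ one has $y^\sigma_I=\partial_If^\sigma$. Put $$\partial^{j_1\dots j_k}_\sigma=\frac{r_1!\cdots r_n!}{k!}\frac{\partial}{\partial y^\sigma_{j_1\dots j_k}},\qquad d_i=\frac{\partial}{\partial x^i}+\sum_J y^\sigma_{iJ}\,\partial^J_\sigma,\qquad \omega^\sigma_J=dy^\sigma_J-y^\sigma_{iJ}dx^i\ \ (|J|\le s-1),$$ where $r_l$ is the number of occurrences of $l$ among $j_1,\dots,j_k$; $d_i$ maps functions of order $k$ to functions of order $k+1$, $d_J=d_{j_1}\cdots d_{j_k}$, and all sums over $I$, $J$ run over ordered index tuples. Let $\alpha$ be a smooth closed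 $(n+1)$-form on $P^s_nX$ with $i_\xi\alpha=0$ for every vector field $\xi$ that is vertical for $P^s_nX\to P^{s-1}_nX$. In each chart it has a unique expression $$\alpha=\sum_{k=0}^{n+1}\ \sum_{|I_1|,\dots,|I_k|\le s-1}T^{I_1,\dots,I_k}_{\sigma_1,\dots,\sigma_k,i_{k+1},\dots,i_{n+1}}\,\omega^{\sigma_1}_{I_1}\wedge\dots\wedge\omega^{\sigma_k}_{I_k}\wedge dx^{i_{k+1}}\wedge\dots\wedge dx^{i_{n+1}}$$ with coefficients symmetric in the indices within each $I_a$, and antisymmetric in the pairs $(I_a,\sigma_a)$ and in the $i_b$. Suppose that $T^{I_1,\dots,I_k}_{\dots}=0$ whenever $|I_1|+\dots+|I_k|\ge s$, and that the Lepage condition $T^{I}_{\sigma,i_2,\dots,i_{n+1}}=0$ for all $I\neq\emptyset$ holds. Define the Euler–Lagrange components $T_\sigma$ by $T^{\emptyset}_{\sigma,i_1,\dots,i_n}=T_\sigma\,\varepsilon_{i_1\dots i_n}$. Let $r=\left[\frac{s+1}{2}\right]$. Suppose that on an open subset $U$ of the domain of a chart of $P^s_nX$ induced by a chart of $X$ one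 has $\alpha=d\theta$, where $\theta$ is a smooth $n$-form on $U$ of the form $$\theta=\sum_{k=0}^{n}\ \sum_{|I_1|,\dots,|I_k|\le r-1}L^{I_1,\dots,I_k}_{\sigma_1,\dots,\sigma_k,i_{k+1},\dots,i_n}\,\omega^{\sigma_1}_{I_1}\wedge\dots\wedge\omega^{\sigma_k}_{I_k}\wedge dx^{i_{k+1}}\wedge\dots\wedge dx^{i_n}$$ with the same symmetry properties, the coefficients being smooth functions on $U$. Define the local Lagrangian $L$ by $L_{i_1,\dots,i_n}=L\,\varepsilon_{i_1\dots i_n}$. **Proposition.** 1. $L$ is of order at most $r$: $\partial^I_\sigma L=0$ on $U$ for all $\sigma$ and all $I$ with $r<|I|\le s$. 2. The Euler–Lagrange components of $\alpha$ are the Euler–Lagrange expressions of $L$: for all $\sigma$, over $U$, $$T_\sigma=\sum_{|J|\le r}(-1)^{|J|}\,d_J\,\partial^J_\sigma L .$$ 3. The order $r$ is minimal: if $L'$ is a smooth function on $U$ of order at most $r-1$ (that is, $\partial^I_\sigma L'=0$ for $r\le|I|\le s$) with $T_\sigma=\sum_{|J|\le r}(-1)^{|J|}d_J\partial^J_\sigma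 L'$ over $U$ for all $\sigma$, then the $T_\sigma$ do not depend on the derivatives of order $s$: $\partial^I_\nu T_\sigma=0$ on $U$ for all $\sigma,\nu$ and $|I|=s$. -/

import Mathlib

open Set Filter Topology
open scoped ContDiff Manifold BigOperators

noncomputable section

/-! ## Coordinates of order `s`: `(x^i, y^σ_I)`, `|I| ≤ s` -/

/-- Model space of a manifold of dimension `N = n + m`; coordinates `(x^i, y^σ)`. -/
abbrev Base (n m : ℕ) : Type := (Fin n → ℝ) × (Fin m → ℝ)

/-- Multi-indices `I = {i_1, …, i_k}` (unordered, with repetitions) of length `k ≤ s`. -/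
abbrev MultiIndex (n s : ℕ) : Type := {I : Multiset (Fin n) // Multiset.card I ≤ s}

theorem multiIndex_finite (n s : ℕ) : Finite (MultiIndex n s) := by
  have h : {I : Multiset (Fin n) | Multiset.card I ≤ s}.Finite := by
    refine (Set.finite_Iic (s • (Finset.univ : Finset (Fin n)).val)).subset ?_
    intro I hI
    rw [Set.mem_Iic, Multiset.le_iff_count]
    intro a
    rw [Multiset.count_nsmul, Multiset.count_eq_one_of_mem Finset.univ.nodup (Finset.mem_univ a)]
    simpa using (Multiset.count_le_card a I).trans hI
  exact h.to_subtype

instance multiIndexFintype (n s : ℕ) : Fintype (MultiIndex n s) :=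
  @Fintype.ofFinite _ (multiIndex_finite n s)

/-- The coordinate space of the charts of the Grassmann bundle of order `s`:
points are `(x^i, y^σ_I)` with `|I| ≤ s`. -/
abbrev Jet (n m s : ℕ) : Type := (Fin n → ℝ) × (Fin m → MultiIndex n s → ℝ)

section JetSpace

variable {n m : ℕ}

/-- The coordinate `y^σ_I` (zero if `|I| > s`). -/
def coordY {s : ℕ} (p : Jet n m s) (σ : Fin m) (I : Multiset (Fin n)) : ℝ :=
  if h : Multiset.card I ≤ s then p.2 σ ⟨I, h⟩ else 0

/-- The projection from order `b` to order `a ≤ b` in coordinates. -/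
def trunc {a b : ℕ} (h : a ≤ b) : Jet n m b →L[ℝ] Jet n m a :=
  (ContinuousLinearMap.fst ℝ (Fin n → ℝ) (Fin m → MultiIndex n b → ℝ)).prod
    (ContinuousLinearMap.pi fun σ => ContinuousLinearMap.pi fun J : MultiIndex n a =>
      ((ContinuousLinearMap.proj (R := ℝ) (φ := fun _ : MultiIndex n b => ℝ)
          ⟨J.1, J.2.trans h⟩).comp
        (ContinuousLinearMap.proj (R := ℝ) (φ := fun _ : Fin m => MultiIndex n b → ℝ) σ)).comp
        (ContinuousLinearMap.snd ℝ (Fin n → ℝ) (Fin m → MultiIndex n b → ℝ)))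

/-- The factor `r_1! ⋯ r_n! / k!`, where `k = |I|` and `r_i` counts the occurrences of `i`. -/
def idxWeight (I : Multiset (Fin n)) : ℝ :=
  (∏ i : Fin n, ((I.count i).factorial : ℝ)) / ((Multiset.card I).factorial : ℝ)

/-- The vector field `∂^I_σ = (r_1! ⋯ r_n! / k!) ∂/∂y^σ_I` (zero if `|I| > s`). -/
def vert {s : ℕ} (σ : Fin m) (I : Multiset (Fin n)) : Jet n m s :=
  (0, Pi.single σ fun J : MultiIndex n s => if J.1 = I then idxWeight I else 0)

/-- The function `∂^I_σ f`. -/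
def vertDeriv {s : ℕ} (σ : Fin m) (I : Multiset (Fin n)) (f : Jet n m s → ℝ) :
    Jet n m s → ℝ :=
  fun p => fderiv ℝ f p (vert σ I)

/-- The vector field `d_i = ∂/∂x^i + ∑_{|J| ≤ s - 1} y^σ_{iJ} ∂^J_σ` in order `s`
(the sum running over ordered tuples `J`, i.e. `∑ y^σ_{iJ} ∂/∂y^σ_J` over multi-indices). -/
def totalVec {s : ℕ} (i : Fin n) (p : Jet n m s) : Jet n m s :=
  (Pi.single i 1, fun σ (J : MultiIndex n s) => coordY p σ (i ::ₘ J.1))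

/-- The total derivative `d_i f`: a function of order `s` gives one of order `s + 1`. -/
def totalDeriv {s : ℕ} (i : Fin n) (f : Jet n m s → ℝ) : Jet n m (s + 1) → ℝ :=
  fun p => fderiv ℝ (fun q : Jet n m (s + 1) => f (trunc (Nat.le_succ s) q)) p (totalVec i p)

/-- The iterated total derivative `d_J f = d_{j_1} ⋯ d_{j_k} f`. -/
def iterTotalDeriv {s : ℕ} : (k : ℕ) → (Fin k → Fin n) → (Jet n m s → ℝ) → (Jet n m (s + k) → ℝ)
  | 0, _, f => f
  | k + 1, J, f => totalDeriv (J 0) (iterTotalDeriv k (fun a => J a.succ) f)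

/-- The unordered multi-index of a tuple `(j_1, …, j_k)`. -/
def tupleIdx {k : ℕ} (J : Fin k → Fin n) : Multiset (Fin n) :=
  Multiset.map J (Finset.univ : Finset (Fin k)).val

/-- `∑_{|J| ≤ r} (-1)^{|J|} d_J ∂^J_σ L`, as a function of order `s + r`. -/
def eulerLagrange {s : ℕ} (r : ℕ) (L : Jet n m s → ℝ) (σ : Fin m) : Jet n m (s + r) → ℝ :=
  fun p => ∑ k : Fin (r + 1), (-1 : ℝ) ^ (k : ℕ) * ∑ J : Fin k → Fin n,
    iterTotalDeriv (k : ℕ) J (vertDeriv σ (tupleIdx J) L)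
      (trunc (Nat.add_le_add_left (Nat.le_of_lt_succ k.2) s) p)

/-- The contact form `ω^σ_J = dy^σ_J - y^σ_{iJ} dx^i` at `p`. -/
def contactForm {s : ℕ} (σ : Fin m) (J : MultiIndex n s) (p v : Jet n m s) : ℝ :=
  v.2 σ J - ∑ i : Fin n, coordY p σ (i ::ₘ J.1) * v.1 i

/-- The vectors `∂^{I_1}_{σ_1}, …, ∂^{I_k}_{σ_k}, d_{i_1}, …, d_{i_l}` at `p`. -/
def frame {s k l : ℕ} (p : Jet n m s) (σ : Fin k → Fin m) (I : Fin k → Multiset (Fin n))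
    (i : Fin l → Fin n) : Fin (k + l) → Jet n m s :=
  Fin.append (fun a => vert (σ a) (I a)) (fun b => totalVec (i b) p)

/-- The coefficient `T^{I_1,…,I_k}_{σ_1,…,σ_k,i_{k+1},…,i_q}` of a `q`-form, `q = k + l`, in
`α = ∑_k ∑ T^{I_1,…,I_k}_{σ_1,…,σ_k,i_{k+1},…,i_q}
  ω^{σ_1}_{I_1} ∧ ⋯ ∧ ω^{σ_k}_{I_k} ∧ dx^{i_{k+1}} ∧ ⋯ ∧ dx^{i_q}`.
The sums run over all index tuples, with coefficients antisymmetric in the pairs `(σ_a, I_a)` and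
in the `i_b`; hence each coefficient is `1 / (k! l!)` times the value of the form on the frame
`∂^I_σ, d_i`, which is dual to the coframe `ω^σ_I, dx^i` (for `|I| = s`, where there is no contact
form, read `dy^σ_I` in place of `ω^σ_I`). -/
def coeff {s q k l : ℕ} (h : k + l = q) (α : Jet n m s → Jet n m s [⋀^Fin q]→L[ℝ] ℝ)
    (σ : Fin k → Fin m) (I : Fin k → Multiset (Fin n)) (i : Fin l → Fin n) (p : Jet n m s) : ℝ :=
  α p (fun a => frame p σ I i (Fin.cast h.symm a)) / ((k.factorial : ℝ) * (l.factorial : ℝ))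

theorem contactForm_totalVec {s : ℕ} (σ : Fin m) (J : MultiIndex n s) (i : Fin n)
    (p : Jet n m s) : contactForm σ J p (totalVec i p) = 0 := by
  simp [contactForm, totalVec, Pi.single_apply]

theorem contactForm_vert {s : ℕ} (σ ν : Fin m) (J : MultiIndex n s) (I : Multiset (Fin n))
    (p : Jet n m s) :
    contactForm σ J p (vert ν I) = if σ = ν ∧ J.1 = I then idxWeight I else 0 := by
  by_cases h : σ = ν
  · subst h
    simp [contactForm, vert]
  · simp [contactForm, vert, h]

/-- The Euler–Lagrange components `T_σ` of an `(n+1)`-form, given by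
`T^∅_{σ,i_1,…,i_n} = T_σ ε_{i_1,…,i_n}`, i.e. `T_σ = T^∅_{σ,1,…,n}`. -/
def eulerLagrangeComponent {s : ℕ} (α : Jet n m s → Jet n m s [⋀^Fin (n + 1)]→L[ℝ] ℝ)
    (σ : Fin m) : Jet n m s → ℝ :=
  coeff (Nat.add_comm 1 n) α (fun _ : Fin 1 => σ) (fun _ => 0) (fun a : Fin n => a)

/-- The local Lagrangian `L` of an `n`-form, given by `L_{i_1,…,i_n} = L ε_{i_1,…,i_n}`,
i.e. `L = L_{1,…,n}`. -/
def localLagrangian {s : ℕ} (θ : Jet n m s → Jet n m s [⋀^Fin n]→L[ℝ] ℝ) : Jet n m s → ℝ :=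
  coeff (Nat.zero_add n) θ (fun a : Fin 0 => a.elim0) (fun a => a.elim0) (fun a : Fin n => a)

/-- The coordinate expression of `θ` on `U` contains only the `dx^i` and the `ω^σ_I` with
`|I| ≤ r - 1`: all coefficients with some `|I_a| ≥ r` vanish. -/
def HasContactOrderLT {s q : ℕ} (r : ℕ) (U : Set (Jet n m s))
    (θ : Jet n m s → Jet n m s [⋀^Fin q]→L[ℝ] ℝ) : Prop :=
  ∀ (k l : ℕ) (h : k + l = q) (σ : Fin k → Fin m) (I : Fin k → Multiset (Fin n))
    (i : Fin l → Fin n), (∃ a, r ≤ Multiset.card (I a)) → ∀ p ∈ U, coeff h θ σ I i p = 0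

/-- The map `t ↦ (x + t, ∑_{k ≤ s} (1/k!) y^σ_{j_1…j_k} t^{j_1} ⋯ t^{j_k})`, whose graph is the
`n`-dimensional submanifold with derivatives `y^σ_I` at `x`. -/
def graphMap {s : ℕ} (p : Jet n m s) (t : Fin n → ℝ) : Base n m :=
  (p.1 + t, fun σ => ∑ k : Fin (s + 1), (1 / ((k : ℕ).factorial : ℝ)) *
    ∑ J : Fin k → Fin n, coordY p σ (tupleIdx J) * ∏ a, t (J a))

end JetSpace

/-! ## The Grassmann bundle `P^s_n X` of contact elements and differential forms on it -/

section Grassmann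

variable (n m s : ℕ) (X : Type*) [TopologicalSpace X] [ChartedSpace (Base n m) X]

/-- A representative of a regular velocity: a map `ℝⁿ → X`, smooth near `0` and immersive at `0`. -/
structure ImmersionGerm where
  toFun : (Fin n → ℝ) → X
  smooth : ∀ᶠ t in 𝓝 (0 : Fin n → ℝ),
    ContMDiffAt 𝓘(ℝ, Fin n → ℝ) 𝓘(ℝ, Base n m) ∞ toFun t
  immersive : Function.Injective (mfderiv 𝓘(ℝ, Fin n → ℝ) 𝓘(ℝ, Base n m) toFun 0)

variable {n m s X}

/-- Same value and same partial derivatives up to order `s` at `0` in a chart. -/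
def SameJet (s : ℕ) (γ δ : (Fin n → ℝ) → X) : Prop :=
  γ 0 = δ 0 ∧ ∀ k ≤ s,
    iteratedFDeriv ℝ k (fun t => chartAt (Base n m) (γ 0) (γ t)) 0 =
      iteratedFDeriv ℝ k (fun t => chartAt (Base n m) (γ 0) (δ t)) 0

/-- Two immersions have the same `s`-jet at `0` after a reparametrization fixing `0` and
invertible at `0`. -/
def ContactRel (s : ℕ) (γ δ : ImmersionGerm n m X) : Prop :=
  ∃ φ : (Fin n → ℝ) → (Fin n → ℝ), ContDiff ℝ ∞ φ ∧ φ 0 = 0 ∧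
    Function.Bijective (fderiv ℝ φ 0) ∧
    SameJet (n := n) (m := m) s (fun t => γ.toFun (φ t)) δ.toFun

variable (n m s X) in
/-- The `s`-contact elements of `n`-dimensional submanifolds of `X`: the points of `P^s_n X`. -/
def ContactElement : Type _ := Quot (ContactRel (n := n) (m := m) (X := X) s)

/-- `p = (x^i, y^σ_I)` are the coordinates of the contact element `c` in the chart of `P^s_n X`
associated with the chart `ψ = (x^i, y^σ)` of `X`. -/
def HasCoords (ψ : OpenPartialHomeomorph X (Base n m)) (c : ContactElement n m s X)
    (p : Jet n m s) : Prop :=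
  graphMap p 0 ∈ ψ.target ∧
    ∃ γ : ImmersionGerm n m X, Quot.mk _ γ = c ∧ γ.toFun =ᶠ[𝓝 0] fun t => ψ.symm (graphMap p t)

/-- The range of the coordinates of the chart of `P^s_n X` associated with `ψ`. -/
def chartRange (s : ℕ) (ψ : OpenPartialHomeomorph X (Base n m)) : Set (Jet n m s) :=
  {p | (p.1, fun σ => coordY p σ 0) ∈ ψ.target}

/-- A smooth `q`-form on `P^s_n X`: its expressions in the associated charts of all the smooth
charts `ψ` of `X`, compatible with the changes of coordinates `τ` of `P^s_n X`. -/
structure GrassmannForm (n m s q : ℕ) (X : Type*) [TopologicalSpace X]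
    [ChartedSpace (Base n m) X] where
  form : OpenPartialHomeomorph X (Base n m) → Jet n m s → Jet n m s [⋀^Fin q]→L[ℝ] ℝ
  smooth : ∀ ψ ∈ IsManifold.maximalAtlas 𝓘(ℝ, Base n m) ∞ X,
    ContDiffOn ℝ ∞ (form ψ) (chartRange s ψ)
  compatible : ∀ ψ ∈ IsManifold.maximalAtlas 𝓘(ℝ, Base n m) ∞ X,
    ∀ ψ' ∈ IsManifold.maximalAtlas 𝓘(ℝ, Base n m) ∞ X,
    ∀ (p : Jet n m s) (τ : Jet n m s → Jet n m s),
      (∀ᶠ z in 𝓝 p, ∃ c : ContactElement n m s X, HasCoords ψ c z ∧ HasCoords ψ' c (τ z)) →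
      form ψ p = (form ψ' (τ p)).compContinuousLinearMap (fderiv ℝ τ p)

namespace GrassmannForm

variable {q : ℕ}

/-- `dα = 0`. -/
def IsClosedForm (α : GrassmannForm n m s q X) : Prop :=
  ∀ ψ ∈ IsManifold.maximalAtlas 𝓘(ℝ, Base n m) ∞ X, ∀ p ∈ chartRange s ψ,
    extDeriv (α.form ψ) p = 0

/-- `α ∈ Ω^s_{q,ξ}(X)`: `i_ξ α = 0` for every `ξ` vertical for `P^s_n X → P^{s-1}_n X`. -/
def KillsVertical (α : GrassmannForm n m s q X) : Prop :=
  ∀ ψ ∈ IsManifold.maximalAtlas 𝓘(ℝ, Base n m) ∞ X, ∀ p ∈ chartRange s ψ,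
    ∀ ξ : Jet n m s, trunc (Nat.sub_le s 1) ξ = 0 →
      ∀ (v : Fin q → Jet n m s) (a : Fin q), v a = ξ → α.form ψ p v = 0

/-- `α ∈ Ω^{s,t}_{q,ξ}(X)`: moreover `T^{I_1,…,I_k}_{…} = 0` if `|I_1| + ⋯ + |I_k| ≥ t`. -/
def MemOmega (t : ℕ) (α : GrassmannForm n m s q X) : Prop :=
  α.KillsVertical ∧
  ∀ ψ ∈ IsManifold.maximalAtlas 𝓘(ℝ, Base n m) ∞ X,
    ∀ (k l : ℕ) (h : k + l = q) (σ : Fin k → Fin m) (I : Fin k → Multiset (Fin n))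
      (i : Fin l → Fin n), t ≤ ∑ a, Multiset.card (I a) →
      ∀ p ∈ chartRange s ψ, coeff h (α.form ψ) σ I i p = 0

/-- The Lepage condition: `T^I_{σ,i_2,…,i_q} = 0` for all `I ≠ ∅`. -/
def Lepage (α : GrassmannForm n m s q X) : Prop :=
  ∀ ψ ∈ IsManifold.maximalAtlas 𝓘(ℝ, Base n m) ∞ X,
    ∀ (l : ℕ) (h : 1 + l = q) (σ : Fin m) (I : Multiset (Fin n)) (i : Fin l → Fin n), I ≠ 0 →
      ∀ p ∈ chartRange s ψ, coeff h (α.form ψ) (fun _ => σ) (fun _ => I) i p = 0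

end GrassmannForm

end Grassmann

end

noncomputable section

/-! ### The frame `d_i`, `∂^I_σ` and forms of bounded contact order. -/

section Jets

variable {n m : ℕ}

/-! Everything follows from contracting `α = dθ` with `∂^I_σ, d_1, …, d_n`. The only nonzero
brackets among these fields are `[∂^I_σ, d_i] = (r_i / |I|) ∂^{I∖i}_σ`, with `r_i` the multiplicity
of `i` in `I`, while `[d_i, d_j] = 0`. With `P^{I,j}_σ = (-1)^j θ(∂^I_σ, d_1, …, d̂_j, …, d_n) /
n!`, the invariant formula for `dθ` becomes the recursion `∂^I_σ L = T^I_σ + ∑_j d_j P^{I,j}_σ + ∑_j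
(r_j / |I|) P^{I∖j,j}_σ` (`vertDeriv_localLagrangian`). The bound on the contact order of `θ` gives
`P^{I,j}_σ = 0` for `|I| ≥ r` (`HasContactOrderLT.eq_zero`), and the Lepage condition gives `T^I_σ =
0` for `I ≠ ∅`.

If `|I| > r`, every term on the right vanishes, which bounds the order of `L`. Summing `(-1)^{|J|}
d_J ∂^J_σ L` over tuples, the two momentum sums of consecutive lengths cancel and only `T_σ`
survives (`sum_iterTotalD_eq_of_recursion`). Minimality is a count of orders: a Lagrangian of order
at most `r - 1` has Euler–Lagrange expressions of order at most `2(r - 1) < s`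
(`vertDeriv_eulerLagrange_eq_zero`).

In coordinates of order `s` the field `d_i` is cut off at the top. The computation is therefore
pulled back to the fixed order `s + r`, where the iterated derivatives of functions of order `s`
that occur are exact; the cut-off error is vertical over order `s - 1`, hence invisible to both `θ`
and `dθ`. -/

theorem idxWeight_ne_zero (I : Multiset (Fin n)) : idxWeight I ≠ 0 := by
  unfold idxWeight
  exact div_ne_zero (Finset.prod_ne_zero_iff.2 fun i _ => by positivity) (by positivity)

theorem idxWeight_cons (j : Fin n) (I : Multiset (Fin n)) :
    idxWeight (j ::ₘ I) =
      ((j ::ₘ I).count j : ℝ) / (Multiset.card (j ::ₘ I) : ℝ) * idxWeight I := by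
  unfold idxWeight
  have h : ∏ i : Fin n, (((j ::ₘ I).count i).factorial : ℝ) =
      ((j ::ₘ I).count j : ℝ) * ∏ i : Fin n, ((I.count i).factorial : ℝ) := by
    rw [← Finset.mul_prod_erase _ _ (Finset.mem_univ j),
      ← Finset.mul_prod_erase _ (fun i => ((I.count i).factorial : ℝ)) (Finset.mem_univ j),
      ← mul_assoc]
    congr 1
    · rw [Multiset.count_cons_self, Nat.factorial_succ]
      push_cast
      ring
    · refine Finset.prod_congr rfl fun i hi => ?_
      rw [Multiset.count_cons_of_ne (Finset.ne_of_mem_erase hi)]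
  rw [h, Multiset.card_cons, Nat.factorial_succ]
  push_cast
  field_simp

/-- The directions in the kernel of `dx^i` and of `ω^σ_I`, `|I| < r`. -/
def highOrder (n m s r : ℕ) : Set (Jet n m s) :=
  {v | v.1 = 0 ∧ ∀ σ (J : MultiIndex n s), Multiset.card J.1 < r → v.2 σ J = 0}

/-- Duality of frame and coframe. For `|I| = s` the convention `coordY = 0` beyond order `s` turns
`contactForm` into `dy^σ_I`, so the top order needs no separate case. -/
theorem eq_sum_frame {s : ℕ} (p v : Jet n m s) :
    v = ∑ i, v.1 i • totalVec i p +
      ∑ c : Fin m × MultiIndex n s,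
        (contactForm c.1 c.2 p v / idxWeight c.2.1) • vert c.1 c.2.1 := by
  refine Prod.ext ?_ ?_
  · ext a
    simp [totalVec, vert, Finset.sum_apply, Prod.fst_sum, Pi.single_apply]
  · ext σ J
    rw [Prod.snd_add, Prod.snd_sum, Prod.snd_sum, Pi.add_apply, Pi.add_apply, Finset.sum_apply,
      Finset.sum_apply, Finset.sum_apply, Finset.sum_apply, Finset.sum_eq_single (σ, J)]
    · have := idxWeight_ne_zero J.1
      simp only [totalVec, Prod.smul_snd, Pi.smul_apply, smul_eq_mul, contactForm, vert,
        Pi.single_eq_same, if_true, div_mul_cancel₀ _ this]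
      rw [← sub_eq_iff_eq_add']
      congr 1
      exact Finset.sum_congr rfl fun i _ => mul_comm _ _
    · rintro ⟨ν, K⟩ - h
      by_cases hσ : σ = ν
      · subst hσ
        have : J.1 ≠ K.1 := fun e => h (by rw [Subtype.ext e])
        simp [vert, this]
      · simp [vert, hσ]
    · simp

/-- The frame `d_i, ∂^I_σ` indexed by a single type. -/
def frameVec {s : ℕ} (p : Jet n m s) : Fin n ⊕ (Fin m × MultiIndex n s) → Jet n m s
  | Sum.inl i => totalVec i p
  | Sum.inr c => vert c.1 c.2.1

/-- The coordinates of a vector in the frame `d_i, ∂^I_σ`. -/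
def frameCoeff {s : ℕ} (p v : Jet n m s) : Fin n ⊕ (Fin m × MultiIndex n s) → ℝ
  | Sum.inl i => v.1 i
  | Sum.inr c => contactForm c.1 c.2 p v / idxWeight c.2.1

theorem sum_frameCoeff_smul {s : ℕ} (p v : Jet n m s) :
    ∑ c, frameCoeff p v c • frameVec p c = v := by
  rw [Fintype.sum_sum_type]
  exact (eq_sum_frame p v).symm

/-- Any selection of frame vectors is, up to order, of the form `∂^{I_1}, …, ∂^{I_k}, d_{i_1}, …`. -/
theorem exists_perm_frame {s q : ℕ} (p : Jet n m s)
    (e : Fin q → Fin n ⊕ (Fin m × MultiIndex n s)) :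
    ∃ (k l : ℕ) (h : k + l = q) (σ : Fin k → Fin m) (I : Fin k → Multiset (Fin n))
      (i : Fin l → Fin n) (π : Equiv.Perm (Fin q)),
      (∀ a, frame p σ I i (Fin.cast h.symm a) = frameVec p (e (π a))) ∧
      ∀ a c, e a = Sum.inr c → ∃ b, I b = c.2.1 := by
  classical
  set S : Finset (Fin q) := Finset.univ.filter fun a => (e a).isRight with hS
  -- `E` lists the slots holding vertical vectors first and then those holding total ones; this is
  -- the reordering `π`.
  set E := finSumEquivOfFinset (s := S) rfl rfl with hE
  have hkl : S.card + Sᶜ.card = q := by simp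
  have hr : ∀ a : Fin S.card, ∃ c, e (E (Sum.inl a)) = Sum.inr c := fun a => by
    have : E (Sum.inl a) ∈ S := by simp [hE]
    exact Sum.isRight_iff.1 (by simpa [hS] using this)
  have hl : ∀ a : Fin Sᶜ.card, ∃ c, e (E (Sum.inr a)) = Sum.inl c := fun a => by
    have : E (Sum.inr a) ∈ Sᶜ := by
      rw [hE, finSumEquivOfFinset_inr]; exact Finset.orderEmbOfFin_mem _ _ _
    exact Sum.isLeft_iff.1 (by simpa [hS] using this)
  choose c hc using hr
  choose d hd using hl
  refine ⟨_, _, hkl, fun a => (c a).1, fun a => (c a).2.1, d,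
    (finCongr hkl.symm).trans (finSumFinEquiv.symm.trans E), fun a => ?_, fun a x hx => ?_⟩
  · obtain ⟨b, rfl⟩ := (finCongr hkl).surjective a
    obtain ⟨b | b, rfl⟩ := finSumFinEquiv.surjective b
    · simp [frame, hc, frameVec]
    · simp [frame, hd, frameVec]
  · obtain ⟨b | b, rfl⟩ := E.surjective a
    · refine ⟨b, ?_⟩
      rw [hc] at hx
      exact congrArg (fun y => y.2.1) (Sum.inr.inj hx)
    · rw [hd] at hx
      cases hx

/-- By multilinearity, `θ p v` expands in values on frame vectors. The expansion of `v a` contains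
only `∂^I_σ` with `|I| ≥ r`, so each remaining term is, up to sign and factorials, a coefficient
assumed to vanish. -/
theorem HasContactOrderLT.eq_zero {s q r : ℕ} {U : Set (Jet n m s)}
    {θ : Jet n m s → Jet n m s [⋀^Fin q]→L[ℝ] ℝ} (h : HasContactOrderLT r U θ)
    {p : Jet n m s} (hp : p ∈ U) (v : Fin q → Jet n m s) (a : Fin q)
    (ha : v a ∈ highOrder n m s r) : θ p v = 0 := by
  classical
  have hv : v = fun b => ∑ c, frameCoeff p (v b) c • frameVec p c :=
    funext fun b => (sum_frameCoeff_smul p (v b)).symm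
  have h1 : θ p v = ∑ e : Fin q → Fin n ⊕ (Fin m × MultiIndex n s),
      θ p fun b => frameCoeff p (v b) (e b) • frameVec p (e b) := by
    conv_lhs => rw [hv]
    exact (θ p).toMultilinearMap.map_sum _
  rw [h1]
  refine Finset.sum_eq_zero fun e _ => ?_
  have h2 := (θ p).toMultilinearMap.map_smul_univ (fun b => frameCoeff p (v b) (e b))
    (fun b => frameVec p (e b))
  refine Eq.trans h2 ?_
  rw [smul_eq_mul, mul_eq_zero]
  by_cases hz : frameCoeff p (v a) (e a) = 0
  · exact Or.inl (Finset.prod_eq_zero (Finset.mem_univ a) hz)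
  right
  obtain ⟨k, l, hkl, σ, I, i, π, hf, hI⟩ := exists_perm_frame p e
  obtain ⟨b, hb⟩ : ∃ b, r ≤ Multiset.card (I b) := by
    rcases hea : e a with c | c
    · rw [hea] at hz
      exact absurd (congrFun ha.1 c) hz
    · obtain ⟨b, hb⟩ := hI a c hea
      refine ⟨b, ?_⟩
      by_contra hlt
      rw [hea] at hz
      refine hz ?_
      rw [hb, not_le] at hlt
      simp [frameCoeff, contactForm, ha.1, ha.2 c.1 c.2 hlt]
  have h3 := h k l hkl σ I i ⟨b, hb⟩ p hp
  rw [coeff, div_eq_zero_iff, or_iff_left (by positivity)] at h3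
  rw [funext hf] at h3
  have h4 := (θ p).toAlternatingMap.map_perm (fun b => frameVec p (e b)) π
  change θ p (fun b => frameVec p (e (π b))) = _ at h4
  rw [h3] at h4
  rcases Int.units_eq_one_or (Equiv.Perm.sign π) with hs | hs <;> rw [hs] at h4
  · simpa using h4.symm
  · simpa using h4.symm

/-- A multilinear map that vanishes as soon as one argument lies in `K` does not see `K`. -/
theorem AlternatingMap.congr_of_sub_mem {E : Type*} [AddCommGroup E] [Module ℝ E] {q : ℕ}
    (f : E [⋀^Fin q]→ₗ[ℝ] ℝ) (K : Set E) (hK : ∀ v a, v a ∈ K → f v = 0)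
    (v w : Fin q → E) (h : ∀ a, v a - w a = 0 ∨ v a - w a ∈ K) : f v = f w := by
  classical
  -- The arguments are exchanged one at a time; each exchange costs a value of `f` with one argument
  -- zero or in `K`.
  have key : ∀ S : Finset (Fin q), f (S.piecewise v w) = f w := fun S => by
    induction S using Finset.induction_on with
    | empty => simp
    | insert a S ha ih =>
      rw [Finset.piecewise_insert, ← sub_add_cancel (v a) (w a), f.map_update_add]
      have h0 : f (Function.update (S.piecewise v w) a (v a - w a)) = 0 := by
        rcases h a with h | h
        · rw [h, f.map_update_zero]
        · exact hK _ a (by rwa [Function.update_self])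
      rw [h0, zero_add, ← ih]
      congr 1
      ext1 b
      by_cases hb : b = a
      · subst hb; simp [ha]
      · simp [hb]
  simpa using key Finset.univ

/-! ### Truncation of jets and the linear algebra of the fields `d_i`. -/

theorem coordY_trunc {a b : ℕ} (h : a ≤ b) (p : Jet n m b) (σ : Fin m)
    (I : Multiset (Fin n)) (hI : Multiset.card I ≤ a) :
    coordY (trunc h p) σ I = coordY p σ I := by
  simp [coordY, hI, hI.trans h, trunc]

theorem trunc_fst {a b : ℕ} (h : a ≤ b) (p : Jet n m b) : (trunc h p).1 = p.1 := rfl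

theorem trunc_snd {a b : ℕ} (h : a ≤ b) (p : Jet n m b) (σ : Fin m) (J : MultiIndex n a) :
    (trunc h p).2 σ J = p.2 σ ⟨J.1, J.2.trans h⟩ := rfl

theorem trunc_vert {a b : ℕ} (h : a ≤ b) (σ : Fin m) (I : Multiset (Fin n)) :
    trunc h (vert σ I) = vert σ I := by
  refine Prod.ext rfl ?_
  ext ν J
  rw [trunc_snd]
  by_cases hν : ν = σ
  · subst hν; simp [vert]
  · simp [vert, hν]

theorem vert_eq_zero {s : ℕ} (σ : Fin m) (I : Multiset (Fin n)) (h : s < Multiset.card I) :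
    vert (s := s) σ I = 0 := by
  refine Prod.ext rfl ?_
  ext ν J
  have : J.1 ≠ I := fun e => absurd J.2 (by rw [e]; omega)
  by_cases hν : ν = σ
  · subst hν; simp [vert, this]
  · simp [vert, hν]

/-- Strictness matters: acting on functions of order `a`, the field `d_i` needs the coordinates
`y^σ_{iJ}` with `|J| = a`, which exist only in order `a + 1 ≤ b`. -/
theorem trunc_totalVec_of_lt {a b : ℕ} (h : a < b) (i : Fin n) (p : Jet n m b) :
    trunc (Nat.le_succ a) (totalVec i (trunc h p)) = trunc h.le (totalVec i p) := by
  refine Prod.ext rfl ?_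
  ext σ J
  rw [trunc_snd, trunc_snd]
  exact coordY_trunc _ _ _ _ (by simpa using J.2)

/-- The field of order `a` has zero components where `|J| = a`, and these are the only ones that can
differ from those computed in order `b`. -/
theorem trunc_totalVec_sub_mem {a b : ℕ} (h : a ≤ b) (i : Fin n) (p : Jet n m b) :
    trunc h (totalVec i p) - totalVec i (trunc h p) ∈ highOrder n m a a := by
  refine ⟨?_, fun σ J hJ => ?_⟩
  · simp [trunc_fst, totalVec]
  · rw [Prod.snd_sub, Pi.sub_apply, Pi.sub_apply, trunc_snd, sub_eq_zero]
    exact (coordY_trunc _ _ _ _ (by simpa using hJ)).symm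

theorem trunc_surjective {a b : ℕ} (h : a ≤ b) :
    Function.Surjective (trunc h : Jet n m b → Jet n m a) := fun p => by
  refine ⟨(p.1, fun σ J => coordY p σ J.1), Prod.ext rfl ?_⟩
  ext σ J
  rw [trunc_snd]
  simp [coordY, J.2]

/-- The linear part of the affine vector field `d_i`. -/
def totalVecLinear {s : ℕ} (i : Fin n) : Jet n m s →L[ℝ] Jet n m s :=
  LinearMap.toContinuousLinearMap
    { toFun := fun v => (0, fun σ (J : MultiIndex n s) => coordY v σ (i ::ₘ J.1))
      map_add' := fun v w => by
        refine Prod.ext (by simp) ?_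
        ext σ J
        simp only [coordY, Prod.snd_add, Pi.add_apply]
        split_ifs <;> simp
      map_smul' := fun c v => by
        refine Prod.ext (by simp) ?_
        ext σ J
        simp only [coordY, Prod.smul_snd, Pi.smul_apply, RingHom.id_apply]
        split_ifs <;> simp }

theorem totalVecLinear_apply {s : ℕ} (i : Fin n) (v : Jet n m s) :
    totalVecLinear i v = (0, fun σ (J : MultiIndex n s) => coordY v σ (i ::ₘ J.1)) := rfl

theorem totalVec_eq {s : ℕ} (i : Fin n) :
    (totalVec i : Jet n m s → Jet n m s) =
      fun p => ((Pi.single i 1, 0) : Jet n m s) + totalVecLinear i p := by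
  ext1 p
  rw [totalVecLinear_apply]
  simp [totalVec]

theorem hasFDerivAt_totalVec {s : ℕ} (i : Fin n) (p : Jet n m s) :
    HasFDerivAt (totalVec i) (totalVecLinear i : Jet n m s →L[ℝ] Jet n m s) p := by
  rw [totalVec_eq]
  exact (totalVecLinear i).hasFDerivAt.const_add _

theorem contDiff_totalVec {s : ℕ} (i : Fin n) :
    ContDiff ℝ ∞ (totalVec i : Jet n m s → Jet n m s) := by
  rw [totalVec_eq]
  exact contDiff_const.add (totalVecLinear i).contDiff

theorem totalVecLinear_totalVec_comm {s : ℕ} (i j : Fin n) (p : Jet n m s) :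
    totalVecLinear i (totalVec j p) = totalVecLinear j (totalVec i p) := by
  rw [totalVecLinear_apply, totalVecLinear_apply]
  refine Prod.ext rfl ?_
  ext σ J
  by_cases h : Multiset.card J.1 + 1 ≤ s
  · simp [coordY, h, totalVec, Multiset.cons_swap i j]
  · simp [coordY, h]

/-- This is the bracket `[∂^I_σ, d_i]`; the factor is the ratio of the weights of `I` and `I∖i`. For
`I = ∅` the quotient `0 / 0 = 0` is the right value. Without `|I| ≤ s` it fails: for `|I| = s + 1`
the left side is zero, the right side need not be. -/
theorem totalVecLinear_vert {s : ℕ} (i : Fin n) (σ : Fin m) (I : Multiset (Fin n))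
    (hI : Multiset.card I ≤ s) :
    totalVecLinear i (vert σ I : Jet n m s) =
      ((I.count i : ℝ) / (Multiset.card I : ℝ)) • vert σ (I.erase i) := by
  rw [totalVecLinear_apply]
  refine Prod.ext (by simp [vert]) ?_
  ext ν J
  rw [Prod.smul_snd, Pi.smul_apply, Pi.smul_apply]
  by_cases hν : ν = σ
  swap
  · simp [coordY, vert, hν]
  subst hν
  by_cases hi : i ∈ I
  · obtain ⟨K, rfl⟩ := Multiset.exists_cons_of_mem hi
    rw [Multiset.erase_cons_head]
    by_cases hJ : J.1 = K
    · subst hJ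
      have : Multiset.card J.1 + 1 ≤ s := by simpa using hI
      simp only [coordY, Multiset.card_cons, this, dif_pos, vert, Pi.single_eq_same, if_true,
        idxWeight_cons, smul_eq_mul]
    · by_cases h : Multiset.card J.1 + 1 ≤ s
      · simp [coordY, vert, h, hJ]
      · simp [coordY, vert, h, hJ]
  · have : i ::ₘ J.1 ≠ I := fun e => hi (e ▸ Multiset.mem_cons_self _ _)
    rw [Multiset.count_eq_zero_of_notMem hi]
    by_cases h : Multiset.card J.1 + 1 ≤ s
    · simp [coordY, vert, h, this]
    · simp [coordY, vert, h]

/-! ### Total derivatives in a fixed order: commutators and the telescoping sum. -/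

/-- The derivation `f ↦ d_i f` along the vector field `d_i` of order `s`. -/
def totalD {s : ℕ} (i : Fin n) (f : Jet n m s → ℝ) : Jet n m s → ℝ :=
  fun p => fderiv ℝ f p (totalVec i p)

/-- The iterated derivation `d_{j_1} ⋯ d_{j_k}` in fixed order `s`. -/
def iterTotalD {s : ℕ} : (k : ℕ) → (Fin k → Fin n) → (Jet n m s → ℝ) → (Jet n m s → ℝ)
  | 0, _, f => f
  | k + 1, J, f => totalD (J 0) (iterTotalD k (fun a => J a.succ) f)

theorem ContDiffOn.fderiv_apply_smooth {E : Type*} [NormedAddCommGroup E] [NormedSpace ℝ E]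
    {V : Set E} (hV : IsOpen V) {f : E → ℝ} (hf : ContDiffOn ℝ ∞ f V) {W : E → E}
    (hW : ContDiff ℝ ∞ W) : ContDiffOn ℝ ∞ (fun p => fderiv ℝ f p (W p)) V :=
  (hf.fderiv_of_isOpen hV (m := ∞) (by simp)).clm_apply hW.contDiffOn

theorem fderiv_fderiv_apply_field {E : Type*} [NormedAddCommGroup E] [NormedSpace ℝ E]
    {V : Set E} (hV : IsOpen V) {f : E → ℝ} (hf : ContDiffOn ℝ ∞ f V) {W : E → E}
    {W' : E →L[ℝ] E} {p : E} (hp : p ∈ V) (hW : HasFDerivAt W W' p) (v : E) :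
    fderiv ℝ (fun q => fderiv ℝ f q (W q)) p v =
      fderiv ℝ (fderiv ℝ f) p v (W p) + fderiv ℝ f p (W' v) := by
  have h1 : DifferentiableAt ℝ (fderiv ℝ f) p :=
    ((hf.fderiv_of_isOpen hV (m := ∞) (by simp)).contDiffAt (hV.mem_nhds hp)).differentiableAt
      (by simp)
  rw [(h1.hasFDerivAt.clm_apply hW).fderiv]
  simp [add_comm]

theorem fderiv_fderiv_symm {E : Type*} [NormedAddCommGroup E] [NormedSpace ℝ E]
    {V : Set E} (hV : IsOpen V) {f : E → ℝ} (hf : ContDiffOn ℝ ∞ f V) {p : E} (hp : p ∈ V)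
    (v w : E) : fderiv ℝ (fderiv ℝ f) p v w = fderiv ℝ (fderiv ℝ f) p w v := by
  have h := (hf.contDiffAt (hV.mem_nhds hp)).isSymmSndFDerivAt (by
    rw [minSmoothness_of_isRCLikeNormedField]
    exact ENat.LEInfty.out)
  exact h.eq v w

theorem fderiv_congr_of_eqOn {E : Type*} [NormedAddCommGroup E] [NormedSpace ℝ E]
    {V : Set E} (hV : IsOpen V) {f g : E → ℝ} (h : EqOn f g V) {p : E} (hp : p ∈ V) :
    fderiv ℝ f p = fderiv ℝ g p :=
  (h.eventuallyEq_of_mem (hV.mem_nhds hp)).fderiv_eq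

theorem tupleIdx_erase {k : ℕ} (J : Fin (k + 1) → Fin n) (a : Fin (k + 1)) :
    (tupleIdx J).erase (J a) = tupleIdx (a.removeNth J) := by
  have : tupleIdx J = J a ::ₘ tupleIdx (a.removeNth J) := by
    unfold tupleIdx
    rw [Fin.univ_succAbove k a, Finset.cons_val, Multiset.map_cons]
    congr 1
    rw [Finset.map_val, Multiset.map_map]
    rfl
  rw [this, Multiset.erase_cons_head]

theorem card_tupleIdx {k : ℕ} (J : Fin k → Fin n) : Multiset.card (tupleIdx J) = k := by
  simp [tupleIdx]

theorem sum_count_tupleIdx {k : ℕ} (J : Fin k → Fin n) (g : Fin n → ℝ) :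
    ∑ j, ((tupleIdx J).count j : ℝ) * g j = ∑ a, g (J a) := by
  rw [← Finset.sum_fiberwise (s := Finset.univ) (g := J)]
  refine Finset.sum_congr rfl fun j _ => ?_
  rw [Finset.sum_congr rfl (g := fun _ => g j) fun a ha => by rw [(Finset.mem_filter.1 ha).2]]
  rw [Finset.sum_const, nsmul_eq_mul, tupleIdx, Multiset.count_map]
  simp [eq_comm, Finset.card_def]

section Derivations

variable {s : ℕ} {V : Set (Jet n m s)} {f g : Jet n m s → ℝ}

theorem totalD_contDiffOn (hV : IsOpen V) (hf : ContDiffOn ℝ ∞ f V) (i : Fin n) :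
    ContDiffOn ℝ ∞ (totalD i f) V :=
  hf.fderiv_apply_smooth hV (contDiff_totalVec i)

theorem vertDeriv_contDiffOn (hV : IsOpen V) (hf : ContDiffOn ℝ ∞ f V) (σ : Fin m) (I : Multiset (Fin n)) :
    ContDiffOn ℝ ∞ (vertDeriv σ I f) V :=
  hf.fderiv_apply_smooth hV contDiff_const

theorem iterTotalD_contDiffOn (hV : IsOpen V) (hf : ContDiffOn ℝ ∞ f V) :
    ∀ (k : ℕ) (J : Fin k → Fin n), ContDiffOn ℝ ∞ (iterTotalD k J f) V
  | 0, _ => hf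
  | k + 1, J => totalD_contDiffOn hV (iterTotalD_contDiffOn hV hf k fun a => J a.succ) (J 0)

theorem totalD_congr (hV : IsOpen V) (h : EqOn f g V) (i : Fin n) : EqOn (totalD i f) (totalD i g) V :=
  fun p hp => by rw [totalD, totalD, fderiv_congr_of_eqOn hV h hp]

theorem vertDeriv_congr (hV : IsOpen V) (h : EqOn f g V) (σ : Fin m) (I : Multiset (Fin n)) :
    EqOn (vertDeriv σ I f) (vertDeriv σ I g) V :=
  fun p hp => by rw [vertDeriv, vertDeriv, fderiv_congr_of_eqOn hV h hp]

theorem iterTotalD_congr (hV : IsOpen V) (h : EqOn f g V) :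
    ∀ (k : ℕ) (J : Fin k → Fin n), EqOn (iterTotalD k J f) (iterTotalD k J g) V
  | 0, _ => h
  | k + 1, J => totalD_congr hV (iterTotalD_congr hV h k fun a => J a.succ) (J 0)

theorem iterTotalD_eq_zero (hV : IsOpen V) (h : EqOn f 0 V) :
    ∀ (k : ℕ) (J : Fin k → Fin n), EqOn (iterTotalD k J f) 0 V
  | 0, _ => h
  | k + 1, J => fun p hp => by
    rw [iterTotalD, totalD_congr hV (iterTotalD_eq_zero hV h k fun a => J a.succ) (J 0) hp]
    simp [totalD, Pi.zero_def]

theorem totalD_comm (hV : IsOpen V) (hf : ContDiffOn ℝ ∞ f V) (i j : Fin n) :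
    EqOn (totalD i (totalD j f)) (totalD j (totalD i f)) V := fun p hp => by
  unfold totalD
  rw [fderiv_fderiv_apply_field hV hf hp (hasFDerivAt_totalVec j p),
    fderiv_fderiv_apply_field hV hf hp (hasFDerivAt_totalVec i p),
    fderiv_fderiv_symm hV hf hp, totalVecLinear_totalVec_comm]

theorem vertDeriv_comm (hV : IsOpen V) (hf : ContDiffOn ℝ ∞ f V) (σ ν : Fin m) (I K : Multiset (Fin n)) :
    EqOn (vertDeriv σ I (vertDeriv ν K f)) (vertDeriv ν K (vertDeriv σ I f)) V := fun p hp => by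
  unfold vertDeriv
  rw [fderiv_fderiv_apply_field hV hf hp (hasFDerivAt_const _ p),
    fderiv_fderiv_apply_field hV hf hp (hasFDerivAt_const _ p),
    fderiv_fderiv_symm hV hf hp]
  simp

theorem vertDeriv_totalD (hV : IsOpen V) (hf : ContDiffOn ℝ ∞ f V) (σ : Fin m) (I : Multiset (Fin n))
    (hI : Multiset.card I ≤ s) (i : Fin n) {p : Jet n m s} (hp : p ∈ V) :
    vertDeriv σ I (totalD i f) p = totalD i (vertDeriv σ I f) p +
      (I.count i : ℝ) / (Multiset.card I : ℝ) * vertDeriv σ (I.erase i) f p := by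
  unfold vertDeriv totalD
  rw [fderiv_fderiv_apply_field hV hf hp (hasFDerivAt_totalVec i p),
    fderiv_fderiv_apply_field hV hf hp (hasFDerivAt_const _ p),
    fderiv_fderiv_symm hV hf hp, totalVecLinear_vert i σ I hI]
  simp

theorem totalD_sum (hV : IsOpen V) {ι : Type*} (A : Finset ι) (c : ι → ℝ) (f : ι → Jet n m s → ℝ)
    (hf : ∀ a ∈ A, ContDiffOn ℝ ∞ (f a) V) (i : Fin n) :
    EqOn (totalD i fun p => ∑ a ∈ A, c a * f a p) (fun p => ∑ a ∈ A, c a * totalD i (f a) p) V :=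
  fun p hp => by
    have hd : ∀ a ∈ A, DifferentiableAt ℝ (f a) p := fun a ha =>
      ((hf a ha).contDiffAt (hV.mem_nhds hp)).differentiableAt (by simp)
    unfold totalD
    rw [fderiv_fun_sum fun a ha => (hd a ha).const_mul (c a), sum_apply]
    refine Finset.sum_congr rfl fun a ha => ?_
    rw [fderiv_const_mul (hd a ha)]
    simp

theorem iterTotalD_sum (hV : IsOpen V) {ι : Type*} (A : Finset ι) (c : ι → ℝ) (f : ι → Jet n m s → ℝ)
    (hf : ∀ a ∈ A, ContDiffOn ℝ ∞ (f a) V) : ∀ (k : ℕ) (J : Fin k → Fin n),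
    EqOn (iterTotalD k J fun p => ∑ a ∈ A, c a * f a p)
      (fun p => ∑ a ∈ A, c a * iterTotalD k J (f a) p) V
  | 0, _ => fun _ _ => rfl
  | k + 1, J => by
    refine (totalD_congr hV (iterTotalD_sum hV A c f hf k fun a => J a.succ) (J 0)).trans ?_
    exact totalD_sum hV A c _ (fun a ha => iterTotalD_contDiffOn hV (hf a ha) _ _) _

theorem totalD_iterTotalD (hV : IsOpen V) (hf : ContDiffOn ℝ ∞ f V) (i : Fin n) :
    ∀ (k : ℕ) (J : Fin k → Fin n),
      EqOn (totalD i (iterTotalD k J f)) (iterTotalD k J (totalD i f)) V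
  | 0, _ => fun _ _ => rfl
  | k + 1, J => by
    refine (totalD_comm hV (iterTotalD_contDiffOn hV hf k fun a => J a.succ) i (J 0)).trans ?_
    exact totalD_congr hV (totalD_iterTotalD hV hf i k fun a => J a.succ) (J 0)

/-- Total derivatives commute, so an index inserted at any position can be moved to the innermost
place. -/
theorem iterTotalD_insertNth (hV : IsOpen V) (hf : ContDiffOn ℝ ∞ f V) (i : Fin n) :
    ∀ (k : ℕ) (a : Fin (k + 1)) (J : Fin k → Fin n),
      EqOn (iterTotalD (k + 1) (a.insertNth i J) f) (iterTotalD k J (totalD i f)) V := by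
  intro k
  induction k with
  | zero =>
    intro a J
    obtain rfl : a = 0 := Fin.eq_zero a
    exact fun p _ => by simp [iterTotalD]
  | succ k ih =>
    intro a J
    refine Fin.cases ?_ (fun b => ?_) a
    · have h0 : (fun a : Fin (k + 1) => (0 : Fin (k + 2)).insertNth (α := fun _ => Fin n) i J a.succ)
          = J := by
        ext1 b; simp
      rw [iterTotalD, h0, Fin.insertNth_apply_same]
      exact totalD_iterTotalD hV hf i _ _
    · have h0 : (fun a : Fin (k + 1) => b.succ.insertNth (α := fun _ => Fin n) i J a.succ)
          = b.insertNth (α := fun _ => Fin n) i (fun a => J a.succ) := by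
        ext1 c
        refine Fin.succAboveCases b ?_ (fun d => ?_) c
        · simp
        · rw [← Fin.succ_succAbove_succ, Fin.insertNth_apply_succAbove,
            Fin.insertNth_apply_succAbove]
      rw [iterTotalD, h0]
      have h1 : b.succ.insertNth (α := fun _ => Fin n) i J 0 = J 0 := by
        rw [← Fin.succ_succAbove_zero b, Fin.insertNth_apply_succAbove]
      rw [h1]
      exact totalD_congr hV (ih b fun a => J a.succ) (J 0)

/-- Summing `d_{j_1} ⋯ d_{j_k}` of a derivative of a multi-index expression undoes the
symmetrization. -/
theorem sum_iterTotalD_symmetrization (hV : IsOpen V) (P : Multiset (Fin n) → Fin n → Jet n m s → ℝ)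
    (hP : ∀ I j, ContDiffOn ℝ ∞ (P I j) V) (k : ℕ) {p : Jet n m s} (hp : p ∈ V) :
    ∑ J : Fin (k + 1) → Fin n, iterTotalD (k + 1) J (fun q => ∑ j,
        ((tupleIdx J).count j : ℝ) / (Multiset.card (tupleIdx J) : ℝ) *
          P ((tupleIdx J).erase j) j q) p =
      ∑ J : Fin k → Fin n, ∑ j, iterTotalD k J (totalD j (P (tupleIdx J) j)) p := by
  -- Weighting each value `j` by its multiplicity in `J` amounts to summing over the positions `a`
  -- of `J`.
  have h1 : ∀ J : Fin (k + 1) → Fin n, iterTotalD (k + 1) J (fun q => ∑ j,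
        ((tupleIdx J).count j : ℝ) / (Multiset.card (tupleIdx J) : ℝ) *
          P ((tupleIdx J).erase j) j q) p =
      ((k : ℝ) + 1)⁻¹ * ∑ a, iterTotalD (k + 1) J (P (tupleIdx (a.removeNth J)) (J a)) p := by
    intro J
    rw [iterTotalD_sum hV _ _ _ (fun j _ => hP _ _) _ _ hp, card_tupleIdx]
    simp_rw [← tupleIdx_erase]
    rw [← sum_count_tupleIdx J fun j => iterTotalD (k + 1) J (P ((tupleIdx J).erase j) j) p,
      Finset.mul_sum]
    refine Finset.sum_congr rfl fun j _ => ?_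
    push_cast
    ring
  simp_rw [h1]
  rw [← Finset.mul_sum, Finset.sum_comm]
  -- Splitting `J` into its entry at `a` and the rest gives a sum independent of `a`; the `k + 1`
  -- equal sums then cancel the factor `1 / (k + 1)`.
  have h2 : ∀ a : Fin (k + 1), ∑ J : Fin (k + 1) → Fin n,
      iterTotalD (k + 1) J (P (tupleIdx (a.removeNth J)) (J a)) p =
      ∑ J : Fin k → Fin n, ∑ j, iterTotalD k J (totalD j (P (tupleIdx J) j)) p := by
    intro a
    rw [← (Fin.insertNthEquiv (fun _ => Fin n) a).sum_comp, Fintype.sum_prod_type_right]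
    refine Finset.sum_congr rfl fun J _ => Finset.sum_congr rfl fun j _ => ?_
    simp only [Fin.insertNthEquiv_apply, Fin.insertNth_apply_same]
    have e : a.removeNth ((Fin.insertNthEquiv (fun _ => Fin n) a) (j, J)) = J :=
      Fin.removeNth_insertNth _ _ _
    rw [e]
    exact iterTotalD_insertNth hV (hP _ _) j k a J hp
  simp_rw [h2]
  rw [Finset.sum_const, Finset.card_univ, Fintype.card_fin, nsmul_eq_mul]
  push_cast
  field_simp

/-- The telescoping of the Euler–Lagrange sum. -/
theorem sum_iterTotalD_eq_of_recursion (hV : IsOpen V) (r : ℕ) (F : Multiset (Fin n) → Jet n m s → ℝ)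
    (P : Multiset (Fin n) → Fin n → Jet n m s → ℝ) (hP : ∀ I j, ContDiffOn ℝ ∞ (P I j) V)
    (hP0 : ∀ I j, Multiset.card I = r → EqOn (P I j) 0 V) (T : Jet n m s → ℝ)
    (h0 : EqOn (F 0) (fun p => T p + ∑ j, totalD j (P 0 j) p) V)
    (hF : ∀ I, I ≠ 0 → Multiset.card I ≤ r → EqOn (F I) (fun p => ∑ j, totalD j (P I j) p +
      ∑ j, (I.count j : ℝ) / (Multiset.card I : ℝ) * P (I.erase j) j p) V)
    {p : Jet n m s} (hp : p ∈ V) :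
    ∑ k : Fin (r + 1), (-1 : ℝ) ^ (k : ℕ) *
      ∑ J : Fin k → Fin n, iterTotalD (k : ℕ) J (F (tupleIdx J)) p = T p := by
  set S : ℕ → ℝ := fun k =>
    ∑ J : Fin k → Fin n, ∑ j, iterTotalD k J (totalD j (P (tupleIdx J) j)) p with hS
  have hstep : ∀ k, k + 1 ≤ r →
      ∑ J : Fin (k + 1) → Fin n, iterTotalD (k + 1) J (F (tupleIdx J)) p = S (k + 1) + S k := by
    intro k hk
    have hlast : S k = _ := (sum_iterTotalD_symmetrization hV P hP k hp).symm
    rw [hlast, hS, ← Finset.sum_add_distrib]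
    refine Finset.sum_congr rfl fun J _ => ?_
    have hJ0 : tupleIdx J ≠ 0 := fun h => by simpa [h] using card_tupleIdx J
    -- Both sums of the recursion are merged over `Fin n ⊕ Fin n`, so that a single use of
    -- `iterTotalD_sum` distributes `d_J`.
    have e1 : EqOn (F (tupleIdx J)) (fun q => ∑ x : Fin n ⊕ Fin n,
        Sum.elim (fun _ => (1 : ℝ)) (fun j => ((tupleIdx J).count j : ℝ) /
          (Multiset.card (tupleIdx J) : ℝ)) x *
        Sum.elim (fun j => totalD j (P (tupleIdx J) j))
          (fun j => P ((tupleIdx J).erase j) j) x q) V := fun q hq => by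
      rw [hF _ hJ0 (by rw [card_tupleIdx]; exact hk) hq]
      beta_reduce
      rw [Fintype.sum_sum_type]
      simp
    have hsm : ∀ x ∈ (Finset.univ : Finset (Fin n ⊕ Fin n)), ContDiffOn ℝ ∞
        (Sum.elim (fun j => totalD j (P (tupleIdx J) j))
          (fun j => P ((tupleIdx J).erase j) j) x) V := by
      rintro (j | j) -
      · exact totalD_contDiffOn hV (hP _ _) _
      · exact hP _ _
    rw [iterTotalD_congr hV e1 _ _ hp, iterTotalD_sum hV _ _ _ hsm _ _ hp,
      iterTotalD_sum hV _ _ _ (fun j _ => hP _ _) _ _ hp]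
    beta_reduce
    rw [Fintype.sum_sum_type]
    simp
  have hzero : ∑ J : Fin 0 → Fin n, iterTotalD 0 J (F (tupleIdx J)) p = T p + S 0 := by
    simp [hS, iterTotalD, tupleIdx, h0 hp]
  have hSr : S r = 0 := by
    refine Finset.sum_eq_zero fun J _ => Finset.sum_eq_zero fun j _ => ?_
    have e : EqOn (totalD j (P (tupleIdx J) j)) 0 V :=
      iterTotalD_eq_zero hV (hP0 _ j (card_tupleIdx J)) 1 fun _ => j
    exact iterTotalD_eq_zero hV e _ _ hp
  -- The term of length `k` is `S k + S (k - 1)`, so the alternating partial sums leave only the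
  -- boundary term `S K`, which is zero at `K = r`.
  have htel : ∀ K, K ≤ r → ∑ k ∈ Finset.range (K + 1), (-1 : ℝ) ^ k *
      ∑ J : Fin k → Fin n, iterTotalD k J (F (tupleIdx J)) p = T p + (-1) ^ K * S K := by
    intro K
    induction K with
    | zero => intro _; simpa using hzero
    | succ K ih =>
      intro hK
      rw [Finset.sum_range_succ, ih (by omega), hstep K hK]
      ring
  rw [Fin.sum_univ_eq_sum_range (fun k => (-1 : ℝ) ^ k *
    ∑ J : Fin k → Fin n, iterTotalD k J (F (tupleIdx J)) p), htel r le_rfl, hSr]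
  simp

end Derivations

/-! ### The exterior derivative evaluated on `∂^I_σ` and the `d_i`. -/

theorem ContDiffOn.continuousAlternatingMap_apply {E F : Type*} [NormedAddCommGroup E]
    [NormedSpace ℝ E] [NormedAddCommGroup F] [NormedSpace ℝ F] {V : Set E} {q : ℕ}
    {β : E → F [⋀^Fin q]→L[ℝ] ℝ} {v : E → Fin q → F} (hβ : ContDiffOn ℝ ∞ β V)
    (hv : ∀ a, ContDiffOn ℝ ∞ (fun x => v x a) V) :
    ContDiffOn ℝ ∞ (fun x => β x (v x)) V := by
  induction q with
  | zero =>
    have : (fun x => β x (v x)) =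
        fun x => (ContinuousAlternatingMap.apply ℝ F ℝ (0 : Fin 0 → F)) (β x) := by
      ext1 x
      rw [Subsingleton.elim (v x) 0]
      rfl
    rw [this]
    exact (ContinuousLinearMap.contDiff _).comp_contDiffOn hβ
  | succ q ih =>
    have h0 : ContDiff ℝ ∞ (fun f : F [⋀^Fin (q + 1)]→L[ℝ] ℝ => f.curryLeft) :=
      LinearIsometry.contDiff (𝕜 := ℝ) (E := F [⋀^Fin (q + 1)]→L[ℝ] ℝ)
        (F := F →L[ℝ] F [⋀^Fin q]→L[ℝ] ℝ) (n := ∞) ContinuousAlternatingMap.curryLeftLI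
    have h1 : ContDiffOn ℝ ∞ (fun x => (β x).curryLeft) V := h0.comp_contDiffOn hβ
    have h2 := ih (h1.clm_apply (hv 0)) (v := fun x => Matrix.vecTail (v x)) fun a => hv a.succ
    refine h2.congr fun x _ => ?_
    rw [ContinuousAlternatingMap.curryLeft_apply_apply]
    congr 1
    exact (Matrix.cons_head_tail (v x)).symm

/-- Contraction of `dβ` with `∂^I_σ, d_{i_0}, …, d_{i_q}`. -/
theorem extDeriv_apply_vert_totalVec {s q : ℕ} {β : Jet n m s → Jet n m s [⋀^Fin (q + 1)]→L[ℝ] ℝ}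
    {p : Jet n m s} (hβ : DifferentiableAt ℝ β p) (σ : Fin m) (I : Multiset (Fin n))
    (hI : Multiset.card I ≤ s) (i : Fin (q + 1) → Fin n) :
    extDeriv β p (Matrix.vecCons (vert σ I) fun j => totalVec (i j) p) =
      vertDeriv σ I (fun x => β x fun j => totalVec (i j) x) p
      - ∑ j : Fin (q + 1), (-1 : ℝ) ^ (j : ℕ) * totalD (i j) (fun x =>
          β x (Matrix.vecCons (vert σ I) (j.removeNth fun b => totalVec (i b) x))) p
      - ∑ j : Fin (q + 1), (-1 : ℝ) ^ (j : ℕ) *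
          ((I.count (i j) : ℝ) / (Multiset.card I : ℝ) *
            β p (Matrix.vecCons (vert σ (I.erase (i j)))
              (j.removeNth fun b => totalVec (i b) p))) := by
  set W : Fin (q + 2) → Jet n m s → Jet n m s :=
    Matrix.vecCons (fun _ => vert σ I) (fun j => totalVec (i j)) with hW
  have hW0 : W 0 = fun _ => vert σ I := rfl
  have hWs : ∀ j : Fin (q + 1), W j.succ = totalVec (i j) := fun j => rfl
  have hd : ∀ a, DifferentiableAt ℝ (W a) p := fun a => by
    refine Fin.cases ?_ (fun j => ?_) a
    · exact differentiableAt_const _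
    · exact (hasFDerivAt_totalVec (i j) p).differentiableAt
  have hWx : ∀ x, (fun a => W a x) = Matrix.vecCons (vert σ I) fun j => totalVec (i j) x :=
    fun x => by
      ext1 a
      refine Fin.cases rfl (fun j => rfl) a
  have hbr0 : ∀ j : Fin (q + 1), VectorField.lieBracket ℝ (W 0) (W j.succ) p =
      ((I.count (i j) : ℝ) / (Multiset.card I : ℝ)) • vert σ (I.erase (i j)) := fun j => by
    rw [VectorField.lieBracket, hW0, hWs, (hasFDerivAt_totalVec (i j) p).fderiv,
      totalVecLinear_vert _ _ _ hI]
    simp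
  have hbrs : ∀ a j : Fin (q + 1), VectorField.lieBracket ℝ (W a.succ) (W j.succ) p = 0 :=
    fun a j => by
      rw [VectorField.lieBracket, hWs, hWs, (hasFDerivAt_totalVec (i j) p).fderiv,
        (hasFDerivAt_totalVec (i a) p).fderiv, totalVecLinear_totalVec_comm, sub_self]
  have h := extDeriv_apply_vectorField hβ hd
  rw [hWx p] at h
  rw [h, Fin.sum_univ_succ, Fin.sum_univ_succ (f := fun a : Fin (q + 1) => ∑ j ≥ a, _)]
  -- Brackets not involving `∂^I_σ` pair two total fields and vanish; only the row of `W 0` is left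
  -- in the double sum.
  have hbr : ∑ a : Fin q, ∑ j ≥ a.succ, (-1 : ℤ) ^ ((a.succ : ℕ) + j : ℕ) •
      β p (Matrix.vecCons (VectorField.lieBracket ℝ (W a.succ.castSucc) (W j.succ) p)
        (j.removeNth (a.succ.castSucc.removeNth
          (Matrix.vecCons (vert σ I) fun j => totalVec (i j) p)))) = 0 :=
    Finset.sum_eq_zero fun a _ => Finset.sum_eq_zero fun j _ => by
      rw [← Fin.succ_castSucc, hbrs, (β p).map_coord_zero 0 rfl, smul_zero]
  have hrem : ∀ (j : Fin (q + 1)) x, j.succ.removeNth (fun a => W a x) =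
      Matrix.vecCons (vert σ I) (j.removeNth fun b => totalVec (i b) x) := fun j x => by
    ext1 a
    refine Fin.cases ?_ (fun b => ?_) a
    · simp [Fin.removeNth, hW]
    · simp [Fin.removeNth, hW]
  have hIci : Finset.Ici (0 : Fin (q + 1)) = Finset.univ := by ext; simp
  rw [hIci, hbr, add_zero, sub_sub]
  rw [sub_eq_add_neg _ (_ + _), neg_add, ← Finset.sum_neg_distrib, ← Finset.sum_neg_distrib,
    add_sub_assoc, sub_eq_add_neg, ← Finset.sum_neg_distrib]
  congr 2
  · simp only [Fin.val_zero, pow_zero, one_smul]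
    rfl
  · refine Finset.sum_congr rfl fun j _ => ?_
    simp only [hrem, hWs, Fin.val_succ, totalD, zsmul_eq_mul]
    push_cast
    ring
  · refine Finset.sum_congr rfl fun j _ => ?_
    rw [Fin.castSucc_zero, hbr0]
    have e := (β p).map_vecCons_smul ((j.removeNth fun b => totalVec (i b) p))
      ((I.count (i j) : ℝ) / (Multiset.card I : ℝ)) (vert σ (I.erase (i j)))
    simp only [Fin.val_zero, zero_add, zsmul_eq_mul, smul_eq_mul] at e ⊢
    push_cast
    exact congrArg (fun y => -((-1 : ℝ) ^ (j : ℕ) * y)) e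

theorem highOrder_anti {s a b : ℕ} (h : a ≤ b) : highOrder n m s b ⊆ highOrder n m s a :=
  fun _ hv => ⟨hv.1, fun σ J hJ => hv.2 σ J (hJ.trans_le h)⟩

theorem trunc_eq_zero_of_mem_highOrder {s : ℕ} (hs : 1 ≤ s) {ξ : Jet n m s}
    (hξ : ξ ∈ highOrder n m s s) : trunc (Nat.sub_le s 1) ξ = 0 := by
  refine Prod.ext hξ.1 ?_
  ext σ J
  rw [trunc_snd]
  exact hξ.2 σ _ (by have := J.2; change Multiset.card J.1 < s; omega)

theorem coeff_one {s l q : ℕ} (h : 1 + l = q + 1) (hl : l = q)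
    (α : Jet n m s → Jet n m s [⋀^Fin (q + 1)]→L[ℝ] ℝ) (σ : Fin m) (I : Multiset (Fin n))
    (i : Fin q → Fin n) (p : Jet n m s) :
    coeff h α (fun _ => σ) (fun _ => I) (fun a => i (Fin.cast hl a)) p =
      α p (Matrix.vecCons (vert σ I) fun j => totalVec (i j) p) / (q.factorial : ℝ) := by
  subst hl
  rw [coeff, Nat.factorial_one, Nat.cast_one, one_mul]
  congr 2
  ext1 a
  rw [frame, Fin.append_left_eq_cons]
  rfl

theorem coeff_zero {s l q : ℕ} (h : 0 + l = q) (hl : l = q)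
    (θ : Jet n m s → Jet n m s [⋀^Fin q]→L[ℝ] ℝ) (σ : Fin 0 → Fin m)
    (I : Fin 0 → Multiset (Fin n)) (i : Fin q → Fin n) (p : Jet n m s) :
    coeff h θ σ I (fun a => i (Fin.cast hl a)) p =
      θ p (fun j => totalVec (i j) p) / (q.factorial : ℝ) := by
  subst hl
  rw [coeff, Nat.factorial_zero, Nat.cast_one, one_mul]
  congr 2
  ext1 a
  rw [frame, Fin.append_left_nil _ _ rfl]
  rfl

/-! ### Passage to jets of higher order. -/

section Truncation

variable {s M q : ℕ} (h : s ≤ M)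

theorem apply_trunc_totalVec {f : Jet n m s [⋀^Fin q]→L[ℝ] ℝ}
    (hf : ∀ v a, v a ∈ highOrder n m s s → f v = 0) (i : Fin q → Fin n) (x : Jet n m M) :
    f (fun j => trunc h (totalVec (i j) x)) = f fun j => totalVec (i j) (trunc h x) :=
  AlternatingMap.congr_of_sub_mem f.toAlternatingMap _ hf _ _
    fun j => Or.inr (trunc_totalVec_sub_mem h (i j) x)

theorem apply_trunc_vecCons {f : Jet n m s [⋀^Fin (q + 1)]→L[ℝ] ℝ}
    (hf : ∀ v a, v a ∈ highOrder n m s s → f v = 0) (i : Fin q → Fin n) (σ : Fin m)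
    (I : Multiset (Fin n)) (x : Jet n m M) :
    f (fun a => trunc h ((Matrix.vecCons (vert σ I) fun j => totalVec (i j) x :
        Fin (q + 1) → Jet n m M) a)) =
      f (Matrix.vecCons (vert σ I) fun j => totalVec (i j) (trunc h x)) := by
  refine AlternatingMap.congr_of_sub_mem f.toAlternatingMap _ hf _ _ fun a => ?_
  refine Fin.cases (Or.inl ?_) (fun j => Or.inr ?_) a
  · rw [Matrix.cons_val_zero, Matrix.cons_val_zero, trunc_vert, sub_self]
  · rw [Matrix.cons_val_succ, Matrix.cons_val_succ]
    exact trunc_totalVec_sub_mem h (i j) x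

theorem fderiv_comp_trunc {f : Jet n m s → ℝ} {x : Jet n m M}
    (hf : DifferentiableAt ℝ f (trunc h x)) (v : Jet n m M) :
    fderiv ℝ (fun y => f (trunc h y)) x v = fderiv ℝ f (trunc h x) (trunc h v) := by
  have := (hf.hasFDerivAt.comp x (trunc h).hasFDerivAt).fderiv
  change fderiv ℝ (f ∘ trunc h) x v = _
  rw [this]
  rfl

theorem vertDeriv_comp_trunc {f : Jet n m s → ℝ} {x : Jet n m M}
    (hf : DifferentiableAt ℝ f (trunc h x)) (σ : Fin m) (I : Multiset (Fin n)) :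
    vertDeriv σ I (fun y => f (trunc h y)) x = vertDeriv σ I f (trunc h x) := by
  rw [vertDeriv, fderiv_comp_trunc h hf, trunc_vert]
  rfl

variable {U : Set (Jet n m s)}

/-- The contraction of `dθ` with `∂^I_σ, d_{i_0}, …, d_{i_q}`, computed in order `M ≥ s`. -/
theorem extDeriv_apply_vert_totalVec_trunc {θ : Jet n m s → Jet n m s [⋀^Fin (q + 1)]→L[ℝ] ℝ}
    (hU : IsOpen U) (hθ : ContDiffOn ℝ ∞ θ U)
    (hθK : ∀ p ∈ U, ∀ v a, v a ∈ highOrder n m s s → θ p v = 0)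
    (hdK : ∀ p ∈ U, ∀ v a, v a ∈ highOrder n m s s → extDeriv θ p v = 0)
    (σ : Fin m) (I : Multiset (Fin n)) (hI : Multiset.card I ≤ M) (i : Fin (q + 1) → Fin n)
    {x : Jet n m M} (hx : trunc h x ∈ U) :
    extDeriv θ (trunc h x) (Matrix.vecCons (vert σ I) fun j => totalVec (i j) (trunc h x)) =
      vertDeriv σ I (fun y => θ (trunc h y) fun j => totalVec (i j) (trunc h y)) x
      - ∑ j : Fin (q + 1), (-1 : ℝ) ^ (j : ℕ) * totalD (i j) (fun y =>
          θ (trunc h y) (Matrix.vecCons (vert σ I)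
            (j.removeNth fun b => totalVec (i b) (trunc h y)))) x
      - ∑ j : Fin (q + 1), (-1 : ℝ) ^ (j : ℕ) *
          ((I.count (i j) : ℝ) / (Multiset.card I : ℝ) *
            θ (trunc h x) (Matrix.vecCons (vert σ (I.erase (i j)))
              (j.removeNth fun b => totalVec (i b) (trunc h x)))) := by
  have hV : IsOpen (trunc h ⁻¹' U : Set (Jet n m M)) := hU.preimage (trunc h).continuous
  -- The pullback of `θ`, written with `fderiv` of the linear map `trunc h` to match
  -- `extDeriv_pullback`.
  set β : Jet n m M → Jet n m M [⋀^Fin (q + 1)]→L[ℝ] ℝ :=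
    fun y => (θ (trunc h y)).compContinuousLinearMap (fderiv ℝ (trunc h) y) with hβ
  have hβa : ∀ y v, β y v = θ (trunc h y) fun a => trunc h (v a) := fun y v => by
    rw [hβ]
    simp only [ContinuousLinearMap.fderiv]
    rfl
  have hd : ∀ y : Jet n m M, trunc h y ∈ U → DifferentiableAt ℝ θ (trunc h y) := fun y hy =>
    (hθ.contDiffAt (hU.mem_nhds hy)).differentiableAt (by simp)
  have hβd : DifferentiableAt ℝ β x := by
    have : β = fun y => (θ (trunc h y)).compContinuousLinearMap (trunc h) := by
      ext1 y
      rw [hβ]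
      simp only [ContinuousLinearMap.fderiv]
    rw [this]
    exact ((hd x hx).comp x (trunc h).differentiableAt).continuousAlternatingMapCompContinuousLinearMap
      (differentiableAt_const _)
  have hext : ∀ v, extDeriv β x v = extDeriv θ (trunc h x) fun a => trunc h (v a) := fun v => by
    rw [hβ, extDeriv_pullback (hd x hx) (trunc h).contDiff.contDiffAt (r := ∞) (by
      rw [minSmoothness_of_isRCLikeNormedField]
      exact ENat.LEInfty.out), ContinuousLinearMap.fderiv]
    rfl
  have key := extDeriv_apply_vert_totalVec hβd σ I hI i
  rw [hext, apply_trunc_vecCons h (hdK _ hx)] at key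
  rw [key]
  have e1 : EqOn (fun y => β y fun j => totalVec (i j) y)
      (fun y => θ (trunc h y) fun j => totalVec (i j) (trunc h y)) (trunc h ⁻¹' U) :=
    fun y hy => (hβa _ _).trans (apply_trunc_totalVec h (hθK _ hy) i y)
  have e2 : ∀ (K : Multiset (Fin n)) (j : Fin (q + 1)),
      EqOn (fun y => β y (Matrix.vecCons (vert σ K) (j.removeNth fun b => totalVec (i b) y)))
      (fun y => θ (trunc h y) (Matrix.vecCons (vert σ K)
        (j.removeNth fun b => totalVec (i b) (trunc h y)))) (trunc h ⁻¹' U) :=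
    fun K j y hy => (hβa _ _).trans
      (apply_trunc_vecCons h (hθK _ hy) (fun b => i (j.succAbove b)) σ K y)
  rw [vertDeriv_congr hV e1 σ I hx]
  congr 1
  · congr 1
    refine Finset.sum_congr rfl fun j _ => ?_
    rw [totalD_congr hV (e2 I j) (i j) hx]
  · refine Finset.sum_congr rfl fun j _ => ?_
    exact congrArg (fun y => (-1 : ℝ) ^ (j : ℕ) *
      ((I.count (i j) : ℝ) / (Multiset.card I : ℝ) * y)) (e2 (I.erase (i j)) j hx)

end Truncation

theorem iterTotalDeriv_contDiffOn {s : ℕ} {U : Set (Jet n m s)} (hU : IsOpen U)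
    {f : Jet n m s → ℝ} (hf : ContDiffOn ℝ ∞ f U) : ∀ (k : ℕ) (J : Fin k → Fin n),
    ContDiffOn ℝ ∞ (iterTotalDeriv k J f) (trunc (Nat.le_add_right s k) ⁻¹' U)
  | 0, _ => hf
  | k + 1, J => by
    have h1 := (iterTotalDeriv_contDiffOn hU hf k fun a => J a.succ).comp
      (trunc (Nat.le_succ (s + k))).contDiff.contDiffOn (fun y hy => hy)
    exact h1.fderiv_apply_smooth
      ((hU.preimage (trunc (Nat.le_add_right s k)).continuous).preimage
        (trunc (Nat.le_succ (s + k))).continuous) (contDiff_totalVec (J 0))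

/-- The iterated total derivative, pulled back to a fixed high order. -/
theorem iterTotalDeriv_trunc {s M : ℕ} {U : Set (Jet n m s)} (hU : IsOpen U)
    {f : Jet n m s → ℝ} (hf : ContDiffOn ℝ ∞ f U) : ∀ (k : ℕ) (J : Fin k → Fin n)
    (h : s + k ≤ M) (x : Jet n m M), trunc ((Nat.le_add_right s k).trans h) x ∈ U →
    iterTotalDeriv k J f (trunc h x) =
      iterTotalD k J (fun y => f (trunc ((Nat.le_add_right s k).trans h) y)) x
  | 0, _, _, _, _ => rfl
  | k + 1, J, h, x, hx => by
    have hk : s + k < M := h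
    have hV : IsOpen (trunc (a := s) (b := M) ((Nat.le_add_right s k).trans hk.le) ⁻¹' U) :=
      hU.preimage (trunc _).continuous
    have hd : DifferentiableAt ℝ (iterTotalDeriv k (fun a => J a.succ) f) (trunc hk.le x) :=
      ((iterTotalDeriv_contDiffOn hU hf k fun a => J a.succ).contDiffAt
        ((hU.preimage (trunc (Nat.le_add_right s k)).continuous).mem_nhds hx)).differentiableAt
        (by simp)
    have e : EqOn (iterTotalD k (fun a => J a.succ)
        fun y => f (trunc ((Nat.le_add_right s k).trans hk.le) y))
        (fun y => iterTotalDeriv k (fun a => J a.succ) f (trunc hk.le y))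
        (trunc ((Nat.le_add_right s k).trans hk.le) ⁻¹' U) := fun y hy =>
      (iterTotalDeriv_trunc hU hf k (fun a => J a.succ) hk.le y hy).symm
    have e' := totalD_congr hV e (J 0) hx
    refine Eq.trans ?_ e'.symm
    rw [totalD, fderiv_comp_trunc hk.le hd]
    change fderiv ℝ (fun q => iterTotalDeriv k (fun a => J a.succ) f
      (trunc (Nat.le_succ (s + k)) q)) (trunc h x) (totalVec (J 0) (trunc h x)) = _
    rw [fderiv_comp_trunc (Nat.le_succ (s + k)) hd]
    congr 1
    exact trunc_totalVec_of_lt hk (J 0) x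

end Jets

/-! ### The Lagrangian, the momenta and their recursion. -/

theorem localLagrangian_eq {q m s : ℕ}
    (θ : Jet (q + 1) m s → Jet (q + 1) m s [⋀^Fin (q + 1)]→L[ℝ] ℝ) (p : Jet (q + 1) m s) :
    localLagrangian θ p = θ p (fun j => totalVec j p) / ((q + 1).factorial : ℝ) :=
  coeff_zero (Nat.zero_add (q + 1)) rfl θ _ _ (fun a => a) p

theorem eulerLagrangeComponent_eq {n m s : ℕ}
    (α : Jet n m s → Jet n m s [⋀^Fin (n + 1)]→L[ℝ] ℝ) (σ : Fin m) (p : Jet n m s) :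
    eulerLagrangeComponent α σ p =
      α p (Matrix.vecCons (vert σ 0) fun j => totalVec j p) / (n.factorial : ℝ) :=
  coeff_one (Nat.add_comm 1 n) rfl α σ 0 (fun a => a) p

/-- The momenta `(-1)^j θ(∂^I_σ, d_1, …, d̂_j, …, d_n) / n!` of an `n`-form. -/
def momentum {q m s : ℕ} (θ : Jet (q + 1) m s → Jet (q + 1) m s [⋀^Fin (q + 1)]→L[ℝ] ℝ)
    (σ : Fin m) (I : Multiset (Fin (q + 1))) (j : Fin (q + 1)) (p : Jet (q + 1) m s) : ℝ :=
  (-1) ^ (j : ℕ) / ((q + 1).factorial : ℝ) *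
    θ p (Matrix.vecCons (vert σ I) (j.removeNth fun b => totalVec b p))

section

variable {q m s r : ℕ} {U : Set (Jet (q + 1) m s)}
  {θ : Jet (q + 1) m s → Jet (q + 1) m s [⋀^Fin (q + 1)]→L[ℝ] ℝ}

theorem localLagrangian_contDiffOn (hθ : ContDiffOn ℝ ∞ θ U) :
    ContDiffOn ℝ ∞ (localLagrangian θ) U := by
  refine ContDiffOn.congr ?_ fun p _ => localLagrangian_eq θ p
  exact (hθ.continuousAlternatingMap_apply fun a =>
    (contDiff_totalVec a).contDiffOn).div_const _

theorem momentum_contDiffOn (hθ : ContDiffOn ℝ ∞ θ U) (σ : Fin m)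
    (I : Multiset (Fin (q + 1))) (j : Fin (q + 1)) : ContDiffOn ℝ ∞ (momentum θ σ I j) U := by
  refine contDiffOn_const.mul (hθ.continuousAlternatingMap_apply fun a => ?_)
  refine Fin.cases ?_ (fun b => ?_) a
  · exact contDiffOn_const
  · exact (contDiff_totalVec _).contDiffOn

theorem vert_mem_highOrder {n : ℕ} (σ : Fin m) {I : Multiset (Fin n)}
    (hI : r ≤ Multiset.card I) : vert σ I ∈ highOrder n m s r := by
  refine ⟨rfl, fun ν J hJ => ?_⟩
  have : J.1 ≠ I := fun e => by rw [e] at hJ; omega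
  by_cases hν : ν = σ
  · subst hν; simp [vert, this]
  · simp [vert, hν]

theorem momentum_eq_zero (hθr : HasContactOrderLT r U θ) (σ : Fin m)
    {I : Multiset (Fin (q + 1))} (hI : r ≤ Multiset.card I) (j : Fin (q + 1))
    {p : Jet (q + 1) m s} (hp : p ∈ U) : momentum θ σ I j p = 0 := by
  rw [momentum, hθr.eq_zero hp _ 0 (vert_mem_highOrder σ hI), mul_zero]

/-- The contraction formula divided by `n!`, with the signs absorbed into `momentum`. It serves
twice: with `M = s` for the order of the Lagrangian, and with `M = s + r` for its Euler–Lagrange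
expressions. -/
theorem vertDeriv_localLagrangian {M : ℕ} (h : s ≤ M) (hU : IsOpen U) (hθ : ContDiffOn ℝ ∞ θ U)
    (hrs : r ≤ s) (hθr : HasContactOrderLT r U θ)
    (hdK : ∀ p ∈ U, ∀ v a, v a ∈ highOrder (q + 1) m s s → extDeriv θ p v = 0)
    (σ : Fin m) (I : Multiset (Fin (q + 1))) (hI : Multiset.card I ≤ M)
    {x : Jet (q + 1) m M} (hx : trunc h x ∈ U) :
    vertDeriv σ I (localLagrangian θ) (trunc h x) =
      extDeriv θ (trunc h x) (Matrix.vecCons (vert σ I) fun j => totalVec j (trunc h x)) /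
        ((q + 1).factorial : ℝ)
      + (∑ j, totalD j (fun y => momentum θ σ I j (trunc h y)) x
      + ∑ j, (I.count j : ℝ) / (Multiset.card I : ℝ) * momentum θ σ (I.erase j) j (trunc h x)) := by
  have hV : IsOpen (trunc h ⁻¹' U : Set (Jet (q + 1) m M)) := hU.preimage (trunc h).continuous
  have hmaps : MapsTo (trunc h) (trunc h ⁻¹' U : Set (Jet (q + 1) m M)) U := fun y hy => hy
  have hL : ContDiffOn ℝ ∞ (fun p => θ p fun j => totalVec j p) U :=
    hθ.continuousAlternatingMap_apply fun a => (contDiff_totalVec a).contDiffOn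
  have hQ : ∀ j : Fin (q + 1), ContDiffOn ℝ ∞
      (fun p => θ p (Matrix.vecCons (vert σ I) (j.removeNth fun b => totalVec b p))) U := fun j =>
    hθ.continuousAlternatingMap_apply fun a =>
      Fin.cases contDiffOn_const (fun b => (contDiff_totalVec _).contDiffOn) a
  have hdiff : ∀ {f : Jet (q + 1) m s → ℝ}, ContDiffOn ℝ ∞ f U →
      DifferentiableAt ℝ (fun y => f (trunc h y)) x := fun hf =>
    ((hf.comp (trunc h).contDiff.contDiffOn hmaps).contDiffAt
      (hV.mem_nhds hx)).differentiableAt (by simp)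
  rw [extDeriv_apply_vert_totalVec_trunc h hU hθ
    (fun p hp v a ha => hθr.eq_zero hp v a (highOrder_anti hrs ha)) hdK σ I hI (fun j => j) hx]
  have e1 : vertDeriv σ I (localLagrangian θ) (trunc h x) =
      ((q + 1).factorial : ℝ)⁻¹ *
        vertDeriv σ I (fun y => θ (trunc h y) fun j => totalVec j (trunc h y)) x := by
    rw [← vertDeriv_comp_trunc h (((localLagrangian_contDiffOn hθ).contDiffAt
      (hU.mem_nhds hx)).differentiableAt (by simp))]
    simp only [vertDeriv, localLagrangian_eq, div_eq_inv_mul]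
    rw [fderiv_const_mul (hdiff hL)]
    rfl
  have e2 : ∀ j : Fin (q + 1), totalD j (fun y => momentum θ σ I j (trunc h y)) x =
      (-1) ^ (j : ℕ) / ((q + 1).factorial : ℝ) * totalD j (fun y =>
        θ (trunc h y) (Matrix.vecCons (vert σ I)
          (j.removeNth fun b => totalVec b (trunc h y)))) x := fun j => by
    simp only [totalD, momentum]
    rw [fderiv_const_mul (hdiff (hQ j))]
    rfl
  have e3 : ∀ j : Fin (q + 1),
      (I.count j : ℝ) / (Multiset.card I : ℝ) * momentum θ σ (I.erase j) j (trunc h x) =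
      ((-1 : ℝ) ^ (j : ℕ) * ((I.count j : ℝ) / (Multiset.card I : ℝ) *
        θ (trunc h x) (Matrix.vecCons (vert σ (I.erase j))
          (j.removeNth fun b => totalVec b (trunc h x))))) / ((q + 1).factorial : ℝ) := fun j => by
    rw [momentum]
    ring
  rw [e1, Finset.sum_congr rfl fun j _ => (e2 j).trans (div_mul_eq_mul_div _ _ _),
    Finset.sum_congr rfl fun j _ => e3 j, ← Finset.sum_div, ← Finset.sum_div]
  ring

end

/-! ### The order of Euler–Lagrange expressions. -/

theorem eulerLagrange_eq_sum_iterTotalD {n m s : ℕ} (r : ℕ) {U : Set (Jet n m s)}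
    (hU : IsOpen U) {L : Jet n m s → ℝ} (hL : ContDiffOn ℝ ∞ L U) (σ : Fin m)
    {p : Jet n m (s + r)} (hp : trunc (Nat.le_add_right s r) p ∈ U) :
    eulerLagrange r L σ p = ∑ k : Fin (r + 1), (-1 : ℝ) ^ (k : ℕ) * ∑ J : Fin k → Fin n,
      iterTotalD (k : ℕ) J
        (fun y => vertDeriv σ (tupleIdx J) L (trunc (Nat.le_add_right s r) y)) p := by
  refine Finset.sum_congr rfl fun k _ => ?_
  congr 1
  exact Finset.sum_congr rfl fun J _ =>
    iterTotalDeriv_trunc hU (vertDeriv_contDiffOn hU hL σ _) k J _ p hp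

/-- If `f` has order at most `a`, then `d_{j_1} ⋯ d_{j_k} f` has order at most `a + k`. -/
theorem vertDeriv_iterTotalD_eq_zero {n m s : ℕ} {V : Set (Jet n m s)} (hV : IsOpen V)
    {f : Jet n m s → ℝ} (hf : ContDiffOn ℝ ∞ f V) {a : ℕ}
    (ha : ∀ (σ : Fin m) (I : Multiset (Fin n)), a < Multiset.card I →
      EqOn (vertDeriv σ I f) 0 V) :
    ∀ (k : ℕ) (J : Fin k → Fin n) (σ : Fin m) (I : Multiset (Fin n)), a + k < Multiset.card I →
      EqOn (vertDeriv σ I (iterTotalD k J f)) 0 V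
  | 0, _, σ, I, hI => ha σ I hI
  | k + 1, J, σ, I, hI => fun p hp => by
    by_cases hs : Multiset.card I ≤ s
    · have ih := vertDeriv_iterTotalD_eq_zero hV hf ha k fun a => J a.succ
      -- Commuting `∂^I_σ` past `d_i` removes at most one index from `I`, so each total derivative
      -- raises the order by at most one.
      rw [iterTotalD, vertDeriv_totalD hV (iterTotalD_contDiffOn hV hf _ _) σ I hs (J 0) hp]
      have h1 : totalD (J 0) (vertDeriv σ I (iterTotalD k (fun a => J a.succ) f)) p = 0 :=
        iterTotalD_eq_zero hV (ih σ I (by omega)) 1 (fun _ => J 0) hp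
      rw [h1, zero_add]
      by_cases hi : J 0 ∈ I
      · have hc := Multiset.card_erase_add_one hi
        rw [ih σ (I.erase (J 0)) (by omega) hp]
        simp
      · simp [Multiset.count_eq_zero_of_notMem hi]
    · rw [vertDeriv, vert_eq_zero σ I (by omega), map_zero]
      rfl

/-- The Euler–Lagrange expressions of a Lagrangian of order less than `r` have order at most
`2 (r - 1)`. -/
theorem vertDeriv_eulerLagrange_eq_zero {n m s r : ℕ} (hr : 1 ≤ r) {U : Set (Jet n m s)}
    (hU : IsOpen U) {L : Jet n m s → ℝ} (hL : ContDiffOn ℝ ∞ L U)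
    (hLr : ∀ (σ : Fin m) (I : Multiset (Fin n)), r ≤ Multiset.card I →
      ∀ p ∈ U, vertDeriv σ I L p = 0) (σ ν : Fin m) (I : Multiset (Fin n))
    (hI : 2 * (r - 1) < Multiset.card I) {p : Jet n m (s + r)}
    (hp : trunc (Nat.le_add_right s r) p ∈ U) : vertDeriv ν I (eulerLagrange r L σ) p = 0 := by
  set h := Nat.le_add_right s r
  have hV : IsOpen (trunc h ⁻¹' U : Set (Jet n m (s + r))) := hU.preimage (trunc h).continuous
  have hsm : ∀ K, ContDiffOn ℝ ∞ (fun y : Jet n m (s + r) => vertDeriv σ K L (trunc h y))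
      (trunc h ⁻¹' U) := fun K =>
    (vertDeriv_contDiffOn hU hL σ K).comp (trunc h).contDiff.contDiffOn fun y hy => hy
  have hsm' : ∀ (k : ℕ) (J : Fin k → Fin n), DifferentiableAt ℝ (iterTotalD k J
      (fun y : Jet n m (s + r) => vertDeriv σ (tupleIdx J) L (trunc h y))) p := fun k J =>
    ((iterTotalD_contDiffOn hV (hsm _) k J).contDiffAt (hV.mem_nhds hp)).differentiableAt (by simp)
  have hterm : ∀ (k : ℕ) (J : Fin k → Fin n), vertDeriv ν I (iterTotalD k J
      (fun y : Jet n m (s + r) => vertDeriv σ (tupleIdx J) L (trunc h y))) p = 0 := fun k J => by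
    -- For `k < r`, `∂^J_σ L` still has order at most `r - 1` and `d_J` adds at most `r - 1`; for `k
    -- ≥ r`, `∂^J_σ L` is zero.
    by_cases hk : k < r
    · refine vertDeriv_iterTotalD_eq_zero hV (hsm _) (a := r - 1) (fun μ K hK y hy => ?_) k J ν I
        (by omega) hp
      rw [vertDeriv_comp_trunc h (((vertDeriv_contDiffOn hU hL σ _).contDiffAt
        (hU.mem_nhds hy)).differentiableAt (by simp)), vertDeriv_comm hU hL μ σ _ _ hy]
      rw [vertDeriv, fderiv_congr_of_eqOn hU (fun z hz => hLr μ K (by omega) z hz) hy]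
      simp
    · have hz := iterTotalD_eq_zero hV (f := fun y : Jet n m (s + r) =>
        vertDeriv σ (tupleIdx J) L (trunc h y))
        (fun y hy => hLr σ _ (by rw [card_tupleIdx]; omega) _ hy) k J
      rw [vertDeriv_congr hV hz ν I hp]
      simp [vertDeriv, Pi.zero_def]
  have e : EqOn (eulerLagrange r L σ) (fun y => ∑ k : Fin (r + 1), (-1 : ℝ) ^ (k : ℕ) *
      ∑ J : Fin k → Fin n, iterTotalD (k : ℕ) J
        (fun y => vertDeriv σ (tupleIdx J) L (trunc h y)) y) (trunc h ⁻¹' U) :=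
    fun y hy => eulerLagrange_eq_sum_iterTotalD r hU hL σ hy
  have hd := HasFDerivAt.fun_sum (u := (Finset.univ : Finset (Fin (r + 1)))) fun k _ =>
    (HasFDerivAt.fun_sum (u := (Finset.univ : Finset (Fin k → Fin n))) fun J _ =>
      (hsm' k J).hasFDerivAt).const_mul ((-1 : ℝ) ^ (k : ℕ))
  rw [vertDeriv_congr hV e ν I hp, vertDeriv, hd.fderiv, sum_apply]
  refine Finset.sum_eq_zero fun k _ => ?_
  rw [smul_apply, sum_apply]
  exact (congrArg _ (Finset.sum_eq_zero fun J _ => hterm k J)).trans (smul_zero _)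

end

/-! ### The proposition. -/

theorem mainTheorem4 {n m s : ℕ} (hn : 1 ≤ n) (hs : 1 ≤ s)
    {X : Type*} [TopologicalSpace X] [ChartedSpace (Base n m) X]
    [IsManifold 𝓘(ℝ, Base n m) ∞ X]
    (α : GrassmannForm n m s (n + 1) X) (hclosed : α.IsClosedForm)
    (hα : α.MemOmega s) (hLepage : α.Lepage)
    (ψ : OpenPartialHomeomorph X (Base n m))
    (hψ : ψ ∈ IsManifold.maximalAtlas 𝓘(ℝ, Base n m) ∞ X)
    (U : Set (Jet n m s)) (hU : IsOpen U) (hUψ : U ⊆ chartRange s ψ)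
    (r : ℕ) (hr : r = (s + 1) / 2)
    (θ : Jet n m s → Jet n m s [⋀^Fin n]→L[ℝ] ℝ) (hθ : ContDiffOn ℝ ∞ θ U)
    (hθr : HasContactOrderLT r U θ)
    (hdθ : ∀ p ∈ U, α.form ψ p = extDeriv θ p) :
    -- the Lagrangian has order at most `r`
    (∀ (σ : Fin m) (I : Multiset (Fin n)), r < Multiset.card I →
      ∀ p ∈ U, vertDeriv σ I (localLagrangian θ) p = 0) ∧
    -- the components `T_σ` are its Euler–Lagrange expressions
    (∀ (σ : Fin m) (p : Jet n m (s + r)), trunc (Nat.le_add_right s r) p ∈ U →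
      eulerLagrangeComponent (α.form ψ) σ (trunc (Nat.le_add_right s r) p) =
        eulerLagrange r (localLagrangian θ) σ p) ∧
    -- minimality of `r`: if the `T_σ` came from a Lagrangian of order at most `r - 1`,
    -- they would not depend on the derivatives of order `s`
    (∀ L' : Jet n m s → ℝ, ContDiffOn ℝ ∞ L' U →
      (∀ (σ : Fin m) (I : Multiset (Fin n)), r ≤ Multiset.card I →
        ∀ p ∈ U, vertDeriv σ I L' p = 0) →
      (∀ (σ : Fin m) (p : Jet n m (s + r)), trunc (Nat.le_add_right s r) p ∈ U →
        eulerLagrangeComponent (α.form ψ) σ (trunc (Nat.le_add_right s r) p) =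
          eulerLagrange r L' σ p) →
      ∀ (σ ν : Fin m) (I : Multiset (Fin n)), Multiset.card I = s →
        ∀ p ∈ U, vertDeriv ν I (eulerLagrangeComponent (α.form ψ) σ) p = 0) := by
  obtain ⟨q, rfl⟩ : ∃ q, n = q + 1 := ⟨n - 1, by omega⟩
  have hrs : r ≤ s := by omega
  have hdK : ∀ p ∈ U, ∀ v a, v a ∈ highOrder (q + 1) m s s → extDeriv θ p v = 0 :=
    fun p hp v a hv => by
      rw [← hdθ p hp]
      exact hα.1 ψ hψ p (hUψ hp) (v a) (trunc_eq_zero_of_mem_highOrder hs hv) v a rfl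
  have hLep : ∀ (σ : Fin m) (I : Multiset (Fin (q + 1))), I ≠ 0 → ∀ p ∈ U,
      extDeriv θ p (Matrix.vecCons (vert σ I) fun j => totalVec j p) /
        ((q + 1).factorial : ℝ) = 0 := fun σ I hI p hp => by
    rw [← hdθ p hp]
    exact (coeff_one (Nat.add_comm 1 (q + 1)) rfl (α.form ψ) σ I (fun a => a) p).symm.trans
      (hLepage ψ hψ (q + 1) (Nat.add_comm 1 (q + 1)) σ I (fun a => a) hI p (hUψ hp))
  refine ⟨fun σ I hI p hp => ?_, fun σ p hp => ?_, fun L' hL' hL'r hEL σ ν I hI p hp => ?_⟩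
  · by_cases hIs : Multiset.card I ≤ s
    · have hI0 : I ≠ 0 := fun e => by simp [e] at hI
      have key := vertDeriv_localLagrangian (le_refl s) hU hθ hrs hθr hdK σ I hIs (x := p) hp
      refine key.trans ((congrArg₂ (· + ·) (hLep σ I hI0 p hp) rfl).trans ?_)
      rw [zero_add, Finset.sum_eq_zero fun j _ => ?_, Finset.sum_eq_zero fun j _ => ?_, add_zero]
      · by_cases hj : j ∈ I
        · have hc := Multiset.card_erase_add_one hj
          -- `|I| > r` leaves `|I∖j| ≥ r`, so even the momentum with one index removed vanishes.
          exact mul_eq_zero_of_right _ (momentum_eq_zero hθr σ (I := I.erase j) (by omega) j hp)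
        · simp [Multiset.count_eq_zero_of_notMem hj]
      · exact iterTotalD_eq_zero hU
          (fun y hy => momentum_eq_zero hθr σ hI.le j hy) 1 (fun _ => j) hp
    · rw [vertDeriv, vert_eq_zero σ I (by omega), map_zero]
  · set h := Nat.le_add_right s r
    have hV : IsOpen (trunc h ⁻¹' U : Set (Jet (q + 1) m (s + r))) :=
      hU.preimage (trunc h).continuous
    rw [eulerLagrange_eq_sum_iterTotalD r hU (localLagrangian_contDiffOn hθ) σ hp]
    symm
    refine sum_iterTotalD_eq_of_recursion hV r
      (fun I y => vertDeriv σ I (localLagrangian θ) (trunc h y))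
      (fun I j y => momentum θ σ I j (trunc h y))
      (fun I j => (momentum_contDiffOn hθ σ I j).comp (trunc h).contDiff.contDiffOn
        fun y hy => hy)
      (fun I j hI y hy => momentum_eq_zero hθr σ hI.ge j hy)
      (fun y => eulerLagrangeComponent (α.form ψ) σ (trunc h y)) (fun y hy => ?_)
      (fun I hI0 hI y hy => ?_) hp
    -- At `I = ∅` all multiplicities are zero, so the last sum drops out and the contraction term is
    -- `T_σ`.
    · have key := vertDeriv_localLagrangian h hU hθ hrs hθr hdK σ 0 (by simp) hy
      rw [← hdθ _ hy, ← eulerLagrangeComponent_eq] at key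
      simpa using key
    · have key := vertDeriv_localLagrangian h hU hθ hrs hθr hdK σ I (by omega) hy
      rwa [hLep σ I hI0 _ hy, zero_add] at key
  · set h := Nat.le_add_right s r
    have hV : IsOpen (trunc h ⁻¹' U : Set (Jet (q + 1) m (s + r))) :=
      hU.preimage (trunc h).continuous
    -- The Euler–Lagrange identity lives in order `s + r`, so the point is lifted there before
    -- differentiating.
    obtain ⟨x, rfl⟩ := trunc_surjective h p
    have hT : ContDiffOn ℝ ∞ (eulerLagrangeComponent (α.form ψ) σ) U := by
      refine ContDiffOn.congr ?_ fun y _ => eulerLagrangeComponent_eq (α.form ψ) σ y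
      exact (((α.smooth ψ hψ).mono hUψ).continuousAlternatingMap_apply fun a =>
        Fin.cases contDiffOn_const (fun b => (contDiff_totalVec _).contDiffOn) a).div_const _
    rw [← vertDeriv_comp_trunc h ((hT.contDiffAt (hU.mem_nhds hp)).differentiableAt (by simp)),
      vertDeriv_congr hV (fun y hy => hEL σ y hy) ν I hp]
    -- `2r ≤ s + 1` yields `2(r - 1) < s`, and `s ≥ 1` yields `r ≥ 1`.
    exact vertDeriv_eulerLagrange_eq_zero (by omega) hU hL' hL'r σ ν I (by omega) hp
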